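/- \textbf{General Speed Scaling.} Fix $\alpha>1$. An instance $\mathcal J$ is a finite set of jobs $J_j=(r_j,d_j,w_j)$ with release time $r_j\ge 0$, deadline $d_j>r_j$ and work $w_j\ge 0$. A (feasible) schedule of $\mathcal J$ assigns to each job $j$ a measurable speed $s_j(t)\ge 0$ that vanishes outside $[r_j,d_j]$ and satisfies $\int_{r_j}^{d_j}s_j(t)\,dt=w_j$ (jobs may run in parallel). Its cost is $\int \big(\sum_j s_j(t)\big)^\alpha dt$, and $\mathrm{OPT}=\mathrm{OPT}(\mathcal J)$ is the infimum of the costs of the schedules of $\mathcal J$. An online algorithm produces a schedule of every instance, and what it does up to any time $t$ depends only on the jobs with $r_j\le t$. For $0<\delta<1$, let $\mathcal J^\delta=\{(r_j,\,r_j+(1-\delta)(d_j-r_j),\,w_j)\}_j$ be the instance obtained from $\mathcal J$ by shrinking the duration of every job by the factor $1-\delta$. \textbf{Theorem.} Let $0<\delta<1$. There is an online procedure that, for every instance $\mathcal J$, converts any schedule $s$ of $\mathcal J^\delta$ into a schedule of $\mathcal J$; online means that the new schedule up to any time $t$ depends only on the jobs with $r_j\le t$ and on $s$ up to time $t$. If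 $C$ is the cost of $s$, then the cost of the new schedule is at most $$\min\left\{\left(\frac1{1-\delta}\right)^{\alpha-1} C,\ \frac{(2\alpha/\delta^2)^\alpha}{2}\cdot \mathrm{OPT}(\mathcal J)\right\}.$$ The procedure does not depend on $\alpha$. In particular, if $\mathcal A$ is an online algorithm, then applying the procedure to the schedules that $\mathcal A$ produces for $\mathcal J^\delta$ gives an online algorithm for $\mathcal J$ with this guarantee. \textbf{Corollary.} There is an absolute constant $K>0$ such that for all $\alpha>1$ and $\varepsilon>0$ there is a learning-augmented online algorithm (it is given a predicted instance at the beginning, and for every fixed prediction it is an online algorithm) with the following guarantees. \begin{itemize} \item Consistency: if the predicted instance is the real instance $\mathcal J$ (up to the names of the jobs), then the cost of the returned schedule is at most $(1+\varepsilon)\,\mathrm{OPT}(\mathcal J)$. \item Robustness: for every prediction and every instance $\mathcal J$, the cost of the returned schedule is at most $\big(K\alpha^3/\min\{\varepsilon,1\}^2\big)^\alpha\cdot \mathrm{OPT}(\mathcal J)$; for $\varepsilon\le 1$ this is $O(\alpha^3/\varepsilon^2)^\alpha\cdot\mathrm{OPT}(\mathcal J)$. \end{itemize} -/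

import Mathlib

open scoped NNReal ENNReal

namespace SpeedScaling

/-- A job `(r, d, w)`: it becomes available at time `r ≥ 0`, must be completed by the deadline
`d > r`, and requires the amount `w ≥ 0` of work. The `index` is only a name: it allows an
instance to contain several jobs with the same data `(r, d, w)`. -/
@[ext]
structure Job where
  index : ℕ
  release : ℝ
  deadline : ℝ
  work : ℝ≥0
  release_nonneg : 0 ≤ release
  release_lt_deadline : release < deadline

/-- The data `(r, d, w)` of a job, without its name. -/
def Job.data (j : Job) : ℝ × ℝ × ℝ≥0 := (j.release, j.deadline, j.work)

/-- The job `(r, r + (1 - δ) (d - r), w)`: its duration is shrunk by the factor `1 - δ`. -/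
def Job.shrink (δ : ℝ) (hδ : δ < 1) (j : Job) : Job where
  index := j.index
  release := j.release
  deadline := j.release + (1 - δ) * (j.deadline - j.release)
  work := j.work
  release_nonneg := j.release_nonneg
  release_lt_deadline := by
    have h1 : 0 < 1 - δ := sub_pos.mpr hδ
    have h2 : 0 < j.deadline - j.release := sub_pos.mpr j.release_lt_deadline
    have h3 := mul_pos h1 h2
    linarith

/-- An instance of General Speed Scaling is a finite set of (named) jobs. -/
abbrev JobSet := Finset Job

open Classical in
/-- The shrunk instance `𝒥^δ`. -/
noncomputable def shrink (δ : ℝ) (hδ : δ < 1) (J : JobSet) : JobSet :=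
  J.image (Job.shrink δ hδ)

/-- `s j t` is the speed at which job `j` is processed at time `t`; jobs may run in parallel.
Only the jobs of the instance at hand matter. -/
abbrev Schedule := Job → ℝ → ℝ≥0

/-- `s` is a feasible schedule of `J`: every job is processed only between its release time and
its deadline, and receives exactly its work there. -/
def Feasible (J : JobSet) (s : Schedule) : Prop :=
  ∀ j ∈ J, Measurable (s j) ∧ (∀ t, t ∉ Set.Icc j.release j.deadline → s j t = 0) ∧
    ∫⁻ t in Set.Icc j.release j.deadline, (s j t : ℝ≥0∞) = j.work

/-- The energy `∫ s(t)^α dt`, where `s(t) = ∑ j, s j t` is the total speed at time `t`. -/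
noncomputable def cost (α : ℝ) (J : JobSet) (s : Schedule) : ℝ≥0∞ :=
  ∫⁻ t, ((∑ j ∈ J, s j t : ℝ≥0) : ℝ≥0∞) ^ α

/-- The cost of an optimal offline schedule of `J`. -/
noncomputable def OPT (α : ℝ) (J : JobSet) : ℝ≥0∞ :=
  ⨅ (s : Schedule) (_ : Feasible J s), cost α J s

/-- The same jobs are released up to time `t` in `J` and in `J'`. -/
def SameJobsUpTo (t : ℝ) (J J' : JobSet) : Prop :=
  ∀ j : Job, j.release ≤ t → (j ∈ J ↔ j ∈ J')

/-- Up to time `t`, the schedules `s` and `s'` treat the jobs of `J` released so far equally. -/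
def SameScheduleUpTo (t : ℝ) (J : JobSet) (s s' : Schedule) : Prop :=
  ∀ j ∈ J, j.release ≤ t → ∀ τ ≤ t, s j τ = s' j τ

/-- A (deterministic) online algorithm for General Speed Scaling: it produces a feasible schedule
of every instance, and what it does up to time `t` depends only on the jobs released up to
time `t`. -/
def IsOnlineAlgorithm (A : JobSet → Schedule) : Prop :=
  (∀ J, Feasible J (A J)) ∧
    ∀ t J J', SameJobsUpTo t J J' → SameScheduleUpTo t J (A J) (A J')

/-- An online conversion of schedules of `𝒥^δ` into schedules of `𝒥`: from every instance `J` and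
every feasible schedule `s` of the shrunk instance, `R` produces a feasible schedule `R J s` of
`J`, and what it does up to time `t` depends only on the jobs released up to time `t` and on the
part of `s` up to time `t`. -/
def IsOnlineConversion (δ : ℝ) (hδ : δ < 1) (R : JobSet → Schedule → Schedule) : Prop :=
  (∀ J s, Feasible (shrink δ hδ J) s → Feasible J (R J s)) ∧
    ∀ t J J' s s', Feasible (shrink δ hδ J) s → Feasible (shrink δ hδ J') s' →
      SameJobsUpTo t J J' → SameScheduleUpTo t (shrink δ hδ J) s s' →
      SameScheduleUpTo t J (R J s) (R J' s')

/-- A learning-augmented online algorithm: it is given a predicted instance `P` at the beginning,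
and then the real instance online. -/
def IsLearningAugmented (A : JobSet → JobSet → Schedule) : Prop :=
  ∀ P, IsOnlineAlgorithm (A P)

/-- The prediction `P` for `J` is accurate: up to the names of the jobs, both contain the same
jobs, with the same multiplicities. -/
def Accurate (P J : JobSet) : Prop :=
  P.val.map Job.data = J.val.map Job.data

end SpeedScaling

open SpeedScaling

/-! The conversion follows the given schedule, which finishes every job within the first fraction `1
- δ` of its lifetime, as long as the total speed is at most `(1 - δ) / δ²` times the Average Rate
speed ρ. Work above this cap is cut off from the jobs in proportion to their speeds. What job `j`
loses at time `u` is spread evenly over the next `δ (d - r)` time units, which end before its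
deadline. Only the past is consulted, so the conversion is online.

Robustness is a pointwise bound. The deferred work of a live job adds at most density / δ, and `(1 -
δ) / δ² + 1 / δ = 1 / δ²`, so the new speed is at most ρ / δ². By `lintegral_averageRate_rpow_le`,
Average Rate is competitive: ∫ρ^α is a sum over jobs of density times ∫ρ^(α-1) over the lifetime;
the mean of ρ^(α-1) there is at most the larger of its left and right maximal functions at any time
when a competing schedule runs the job; Hölder and the maximal inequality with Doob's constant
finish.

For the factor `(1 / (1 - δ)) ^ (α - 1)`, cut speeds into levels, level x having weight α x^(α-1).
Deferred work keeps the levels between cap and total speed from which it was removed. By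
`FeasibleEarly.sum_window_layer_le`, at each time each level is executed at rate at most δ / (1 - δ)
by deferred work, hence at most 1 / (1 - δ) times in all. The bathtub principle
`rpow_lintegral_le_of_le` then bounds the power of the speed by this factor times the weights of the
levels used, and over all times these weights sum to at most the cost of the given schedule.

The learning-augmented algorithm converts a good schedule of the shrunk prediction. Shrinking itself
costs only `(1 / (1 - δ)) ^ (α - 1)` (`exists_feasible_shrink_cost_le`): a minimizing cell-wise
schedule of the shrunk instance carries job prices that pay for it. The superlevel sets of the price
function are unions of lifetimes, and shrinking the lifetimes loses at most the factor `1 - δ` of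
their measure. Taking `δ = min ε 1 / (8 α)` keeps the product of both factors below `1 + ε`. -/

namespace SpeedScaling

open MeasureTheory Set Filter Topology

/-! ### One-sided maximal functions and the rising sun lemma -/

/-- The rising sun function of `H` with respect to finitely many starting points. -/
theorem exists_risingSun (H : ℝ → ℝ) {C : ℝ≥0} (hH : LipschitzWith C H) (F : Finset ℝ) :
    ∃ K : ℝ → ℝ, LipschitzWith C K ∧ (∀ t, 0 ≤ K t) ∧
      (∀ t, 0 < K t ↔ ∃ r ∈ F, r < t ∧ H r < H t) ∧
      ∀ t ∉ F, ∃ c, ∀ᶠ x in 𝓝 t, K x = max 0 (H x - c) := by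
  classical
  induction F using Finset.induction_on with
  | empty =>
    refine ⟨fun _ => 0, LipschitzWith.const' 0, fun _ => le_rfl, by simp, fun t _ => ⟨H t + 1, ?_⟩⟩
    filter_upwards [hH.continuous.continuousAt.eventually_lt continuousAt_const
      (show H t < H t + 1 by linarith)] with x hx
    rw [max_eq_left (by linarith)]
  | insert r F _ ih =>
    obtain ⟨K, hK, hK0, hKpos, hKloc⟩ := ih
    -- Freezing `H` at the value `H r` to the left of `r` makes the contribution of `r` vanish there
    -- without spoiling the Lipschitz constant.
    refine ⟨fun t => max (K t) (max 0 (H (max t r) - H r)), ?_, ?_, ?_, ?_⟩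
    · have h1 : LipschitzWith C fun t => H (max t r) - H r := by
        refine LipschitzWith.of_dist_le_mul fun x y => ?_
        rw [dist_sub_right]
        refine (hH.dist_le_mul _ _).trans ?_
        gcongr
        simpa using (LipschitzWith.id.max_const r).dist_le_mul x y
      have := hK.max (h1.const_max 0)
      simpa using this
    · intro t; exact le_max_of_le_left (hK0 t)
    · intro t
      simp only [lt_max_iff, hKpos, Finset.mem_insert, lt_irrefl, false_or, exists_eq_or_imp, sub_pos]
      constructor
      · rintro (h | h)
        · exact Or.inr h
        · rcases le_or_gt t r with h1 | h1
          · rw [max_eq_right h1] at h; exact absurd h (lt_irrefl _)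
          · rw [max_eq_left h1.le] at h; exact Or.inl ⟨h1, h⟩
      · rintro (⟨h1, h⟩ | h)
        · right; rwa [max_eq_left h1.le]
        · exact Or.inl h
    · intro t ht
      rw [Finset.mem_insert, not_or] at ht
      obtain ⟨c, hc⟩ := hKloc t ht.2
      rcases lt_or_gt_of_ne ht.1 with h | h
      · refine ⟨c, ?_⟩
        filter_upwards [hc, eventually_lt_nhds h] with x hx hxr
        simp [hx, max_eq_right hxr.le]
      · refine ⟨min c (H r), ?_⟩
        filter_upwards [hc, eventually_gt_nhds h] with x hx hxr
        rw [hx, max_eq_left hxr.le]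
        rcases le_total c (H r) with h2 | h2
        · rw [min_eq_left h2, max_eq_left]
          exact max_le_max le_rfl (by linarith)
        · rw [min_eq_right h2, max_eq_right]
          exact max_le_max le_rfl (by linarith)

/-- **Rising sun lemma** for finitely many starting points. -/
theorem risingSun_integral_nonneg {h : ℝ → ℝ} (hm : Measurable h) {C : ℝ≥0}
    (hC : ∀ t, |h t| ≤ C) (F : Finset ℝ) {a T : ℝ} (haT : a ≤ T) (haF : ∀ r ∈ F, a ≤ r) :
    0 ≤ ∫ t in Ioc a T, {t | ∃ r ∈ F, r < t ∧ 0 < ∫ x in r..t, h x}.indicator h t := by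
  have hint : ∀ b c : ℝ, IntervalIntegrable h volume b c := fun b c =>
    (intervalIntegrable_const (c := (C : ℝ))).mono_fun' hm.aestronglyMeasurable
      (Eventually.of_forall fun t => by simpa using hC t)
  have hli : LocallyIntegrable h volume := fun x => by
    refine ⟨Icc (x - 1) (x + 1), Icc_mem_nhds (by linarith) (by linarith), ?_⟩
    rw [integrableOn_Icc_iff_integrableOn_Ioc]
    exact ((intervalIntegrable_iff_integrableOn_Ioc_of_le (by linarith)).1 (hint _ _))
  set H : ℝ → ℝ := fun t => ∫ x in a..t, h x with hHdef
  have hsub : ∀ r t, H t - H r = ∫ x in r..t, h x := fun r t =>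
    intervalIntegral.integral_interval_sub_left (hint _ _) (hint _ _)
  have hH : LipschitzWith C H := by
    refine LipschitzWith.of_dist_le_mul fun x y => ?_
    rw [Real.dist_eq, Real.dist_eq, hsub]
    exact intervalIntegral.norm_integral_le_of_norm_le_const (f := h) (fun t _ => hC t)
  obtain ⟨K, hK, hK0, hKpos, hKloc⟩ := exists_risingSun H hH F
  have hset : ∀ t, (t ∈ {t | ∃ r ∈ F, r < t ∧ 0 < ∫ x in r..t, h x}) ↔ 0 < K t := by
    intro t
    rw [hKpos]
    simp only [mem_ofPred_eq, ← hsub, sub_pos]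
  have hKa : K a = 0 := by
    refine le_antisymm (not_lt.1 fun hlt => ?_) (hK0 a)
    obtain ⟨r, hr, hra, _⟩ := (hKpos a).1 hlt
    exact absurd hra (not_lt.2 (haF r hr))
  have hac : AbsolutelyContinuousOnInterval K a T :=
    (hK.lipschitzOnWith (s := uIcc a T)).absolutelyContinuousOnInterval
  have hftc := hac.integral_deriv_eq_sub
  rw [hKa, sub_zero, intervalIntegral.integral_of_le haT] at hftc
  -- Where `K` is positive it is locally `H` minus a constant; where it vanishes it has a minimum.
  -- So the integral in question is that of `deriv K`, namely `K T - K a = K T`.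
  have hae : ∀ᵐ t ∂(volume.restrict (Ioc a T)), deriv K t =
      {t | ∃ r ∈ F, r < t ∧ 0 < ∫ x in r..t, h x}.indicator h t := by
    refine ae_restrict_of_ae ?_
    have hF : ∀ᵐ t ∂(volume : Measure ℝ), t ∉ F := by
      have := (F.finite_toSet.countable).ae_notMem (volume : Measure ℝ)
      simpa using this
    filter_upwards [LocallyIntegrable.ae_hasDerivAt_integral hli, hF] with t ht htF
    by_cases hpos : 0 < K t
    · rw [indicator_of_mem ((hset t).2 hpos)]
      obtain ⟨c, hc⟩ := hKloc t htF
      have h1 : ∀ᶠ x in 𝓝 t, K x = H x - c := by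
        filter_upwards [hc, hK.continuous.continuousAt.eventually_const_lt hpos] with x hx hx0
        rw [hx] at hx0 ⊢
        exact max_eq_right (by rcases lt_max_iff.1 hx0 with h | h; exacts [absurd h (lt_irrefl _), h.le])
      have h2 : HasDerivAt (fun x => H x - c) (h t) t := (ht a).sub_const c
      exact (h2.congr_of_eventuallyEq h1).deriv
    · rw [indicator_of_notMem (fun hmem => hpos ((hset t).1 hmem))]
      have hz : K t = 0 := le_antisymm (not_lt.1 hpos) (hK0 t)
      exact IsLocalMin.deriv_eq_zero (Eventually.of_forall fun x => by rw [hz]; exact hK0 x)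
  rw [← integral_congr_ae hae, hftc]
  exact hK0 T

/-- The largest average of `g` over an interval `[r, t]` with `r ∈ F`. -/
noncomputable def leftMax (F : Finset ℝ) (g : ℝ → ℝ≥0) (t : ℝ) : ℝ≥0 :=
  F.sup fun r => if r < t then ((∫ x in r..t, (g x : ℝ)) / (t - r)).toNNReal else 0

/-- Turns superlevel sets into the sets of the rising sun lemma for `g - c`. As `c` is nonnegative,
the default value 0 for starting points not before `t` never counts. -/
theorem lt_leftMax_iff {F : Finset ℝ} {g : ℝ → ℝ≥0} {t : ℝ} {c : ℝ} (hc : 0 ≤ c) :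
    c < leftMax F g t ↔ ∃ r ∈ F, r < t ∧ c * (t - r) < ∫ x in r..t, (g x : ℝ) := by
  lift c to ℝ≥0 using hc
  rw [NNReal.coe_lt_coe, leftMax, Finset.lt_sup_iff]
  refine exists_congr fun r => and_congr_right fun _ => ?_
  by_cases h : r < t
  · simp [h, Real.lt_toNNReal_iff_coe_lt, lt_div_iff₀ (sub_pos.2 h)]
  · simp [h]

theorem intervalIntegrable_of_bdd {g : ℝ → ℝ≥0} (hg : Measurable g) {C : ℝ≥0} (hC : ∀ t, g t ≤ C)
    (b c : ℝ) : IntervalIntegrable (fun t => (g t : ℝ)) volume b c :=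
  (intervalIntegrable_const (c := (C : ℝ))).mono_fun' (by fun_prop)
    (Eventually.of_forall fun t => by simpa using hC t)

theorem measurable_leftMax {F : Finset ℝ} {g : ℝ → ℝ≥0} (hg : Measurable g) {C : ℝ≥0}
    (hC : ∀ t, g t ≤ C) : Measurable (leftMax F g) := by
  have hsup : ∀ F : Finset ℝ, (∀ r ∈ F, Measurable fun t =>
      if r < t then ((∫ x in r..t, (g x : ℝ)) / (t - r)).toNNReal else 0) →
      Measurable (leftMax F g) := by
    classical
    intro F
    induction F using Finset.induction_on with
    | empty => intro _; exact measurable_const (a := (0 : ℝ≥0))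
    | insert r F _ ih =>
      intro h
      have e : leftMax (insert r F) g = fun t =>
          (if r < t then ((∫ x in r..t, (g x : ℝ)) / (t - r)).toNNReal else 0) ⊔ leftMax F g t := by
        funext t; rw [leftMax, Finset.sup_insert, leftMax]
      rw [e]
      exact (h r (by simp)).sup (ih fun x hx => h x (by simp [hx]))
  refine hsup F fun r _ => Measurable.ite measurableSet_Ioi ?_ measurable_const
  have : Continuous fun t => ∫ x in r..t, (g x : ℝ) :=
    intervalIntegral.continuous_primitive (fun b c => intervalIntegrable_of_bdd hg hC b c) r
  have := this.measurable
  fun_prop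

theorem leftMax_le {F : Finset ℝ} {g : ℝ → ℝ≥0} {C : ℝ≥0} (hC : ∀ t, g t ≤ C) (t : ℝ) :
    leftMax F g t ≤ C := by
  refine Finset.sup_le fun r _ => ?_
  split_ifs with h
  · rw [Real.toNNReal_le_iff_le_coe, div_le_iff₀ (sub_pos.2 h)]
    have := intervalIntegral.norm_integral_le_of_norm_le_const (a := r) (b := t)
      (f := fun x => (g x : ℝ)) (C := C) (fun x _ => by simpa using hC x)
    rw [abs_of_pos (sub_pos.2 h)] at this
    exact (le_abs_self _).trans this
  · exact zero_le

/-- The weak type inequality for the one-sided maximal function. -/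
theorem mul_measure_lt_leftMax_le {F : Finset ℝ} {g : ℝ → ℝ≥0} (hg : Measurable g) {C : ℝ≥0}
    (hC : ∀ t, g t ≤ C) {a T : ℝ} (haF : ∀ r ∈ F, a ≤ r) {c : ℝ} (hc : 0 < c) :
    ENNReal.ofReal c * volume.restrict (Ioc a T) {t | c < leftMax F g t} ≤
      ∫⁻ t in {t | c < leftMax F g t}, g t ∂(volume.restrict (Ioc a T)) := by
  rcases lt_or_ge T a with haT | haT
  · simp [Ioc_eq_empty_of_le haT.le]
  have hms : MeasurableSet {t | c < leftMax F g t} :=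
    measurableSet_lt measurable_const (measurable_leftMax hg hC).coe_nnreal_real
  have hgi : IntegrableOn (fun t => (g t : ℝ)) (Ioc a T) volume :=
    (intervalIntegrable_iff_integrableOn_Ioc_of_le haT).1 (intervalIntegrable_of_bdd hg hC a T)
  have key := risingSun_integral_nonneg (h := fun t => (g t : ℝ) - c) (C := C + c.toNNReal)
    (by fun_prop) (fun t => by
      rw [NNReal.coe_add, Real.coe_toNNReal _ hc.le, abs_le]
      have h1 : (g t : ℝ) ≤ C := hC t
      have h2 : (0 : ℝ) ≤ g t := (g t).2
      constructor <;> linarith [C.2]) F haT haF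
  have hset : {t | ∃ r ∈ F, r < t ∧ 0 < ∫ x in r..t, ((g x : ℝ) - c)} =
      {t | c < leftMax F g t} := by
    ext t
    rw [mem_ofPred_eq, mem_ofPred_eq, lt_leftMax_iff hc.le]
    refine exists_congr fun r => and_congr_right fun _ => and_congr_right fun _ => ?_
    rw [intervalIntegral.integral_sub (intervalIntegrable_of_bdd hg hC _ _)
      intervalIntegrable_const, intervalIntegral.integral_const, sub_pos, smul_eq_mul, mul_comm]
  rw [hset, integral_indicator hms, integral_sub (hgi.integrable.integrableOn)
    (by simp), integral_const, sub_nonneg, smul_eq_mul] at key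
  have hfin : volume.restrict (Ioc a T) {t | c < leftMax F g t} ≠ ⊤ := measure_ne_top _ _
  have e1 : ∫⁻ t in {t | c < leftMax F g t}, g t ∂(volume.restrict (Ioc a T)) =
      ENNReal.ofReal (∫ t in {t | c < leftMax F g t}, (g t : ℝ) ∂(volume.restrict (Ioc a T))) := by
    rw [ofReal_integral_eq_lintegral_ofReal hgi.integrable.integrableOn
      (Eventually.of_forall fun t => (g t).2)]
    simp
  rw [e1]
  refine le_trans (le_of_eq ?_) (ENNReal.ofReal_le_ofReal key)
  rw [mul_comm, ENNReal.ofReal_mul measureReal_nonneg]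
  rw [measureReal_restrict_apply_univ, Measure.real, ENNReal.ofReal_toReal hfin]

/-! ### From weak type to strong type estimates -/

/-- Solving the inequality `X ≤ C ^ (1 / p) * (A * X) ^ (1 / q)` for `X`. -/
theorem le_of_le_rpow_mul_rpow {p q : ℝ} (hpq : p.HolderConjugate q) {X C A : ℝ≥0∞} (hX : X ≠ ⊤)
    (h : X ≤ C ^ (1 / p) * (A * X) ^ (1 / q)) : X ≤ A ^ (p - 1) * C := by
  have hp0 := hpq.pos
  have hq0 := hpq.symm.pos
  rcases eq_or_ne X 0 with h0 | h0
  · rw [h0]; exact zero_le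
  have hsplit : X = X ^ (1 / p) * X ^ (1 / q) := by
    rw [← ENNReal.rpow_add _ _ h0 hX]
    have : 1 / p + 1 / q = 1 := by have := hpq.inv_add_inv_eq_one; simpa using this
    rw [this, ENNReal.rpow_one]
  have hq1 : 0 < 1 / q := by positivity
  have hXq0 : X ^ (1 / q) ≠ 0 := by simp [ENNReal.rpow_eq_zero_iff, h0, hX]
  have hXqt : X ^ (1 / q) ≠ ⊤ := ENNReal.rpow_ne_top_of_nonneg hq1.le hX
  rw [ENNReal.mul_rpow_of_nonneg _ _ hq1.le, ← mul_assoc] at h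
  nth_rewrite 1 [hsplit] at h
  have h3 := ENNReal.rpow_le_rpow ((ENNReal.mul_le_mul_iff_left hXq0 hXqt).1 h) hp0.le
  rw [ENNReal.mul_rpow_of_nonneg _ _ hp0.le, ← ENNReal.rpow_mul, ← ENNReal.rpow_mul,
    one_div_mul_cancel hp0.ne', ENNReal.rpow_one, ENNReal.rpow_one, ← ENNReal.rpow_mul] at h3
  have hqp : 1 / q * p = p - 1 := by
    have := hpq.mul_eq_add
    field_simp
    linarith
  rwa [hqp, mul_comm] at h3

/-- **Doob's maximal inequality**: a weak type estimate implies the strong type estimate with the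
constant `q / (q - 1)`. -/
theorem lintegral_rpow_le_of_weakType {Ω : Type*} [MeasurableSpace Ω] (μ : Measure Ω)
    [IsFiniteMeasure μ] {m g : Ω → ℝ≥0} (hm : Measurable m) (hg : Measurable g) {C : ℝ≥0}
    (hC : ∀ t, m t ≤ C)
    (hw : ∀ c : ℝ, 0 < c → ENNReal.ofReal c * μ {t | c < m t} ≤ ∫⁻ t in {t | c < m t}, g t ∂μ)
    {p q : ℝ} (hpq : p.HolderConjugate q) :
    ∫⁻ t, (m t : ℝ≥0∞) ^ q ∂μ ≤ ENNReal.ofReal p ^ q * ∫⁻ t, (g t : ℝ≥0∞) ^ q ∂μ := by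
  have hq1 : 1 < q := hpq.symm.lt
  have hq0 : 0 < q := hpq.symm.pos
  have hofr : ∀ (x : ℝ≥0) {y : ℝ}, 0 ≤ y → ENNReal.ofReal ((x : ℝ) ^ y) = (x : ℝ≥0∞) ^ y := by
    intro x y hy
    rw [← ENNReal.ofReal_rpow_of_nonneg x.coe_nonneg hy, ENNReal.ofReal_coe_nnreal]
  have l1 := lintegral_rpow_eq_lintegral_meas_lt_mul μ (f := fun t => (m t : ℝ))
    (Eventually.of_forall fun t => (m t).2) (by fun_prop) hq0
  set ν := μ.withDensity fun t => (g t : ℝ≥0∞) with hν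
  have l2 := lintegral_rpow_eq_lintegral_meas_lt_mul ν (f := fun t => (m t : ℝ))
    (Eventually.of_forall fun t => (m t).2) (by fun_prop) (sub_pos.2 hq1)
  simp only [hofr _ hq0.le, hofr _ (sub_pos.2 hq1).le] at l1 l2
  have hms : ∀ c : ℝ, MeasurableSet {t | c < m t} := fun c =>
    measurableSet_lt measurable_const hm.coe_nnreal_real
  -- The weak type estimate says `c * μ {c < m} ≤ ν {c < m}`. Integrating it against a multiple of
  -- c^(q-2) compares the two layer cake formulas, with constant q / (q - 1) = p.
  have hle : ∫⁻ t, (m t : ℝ≥0∞) ^ q ∂μ ≤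
      ENNReal.ofReal p * ∫⁻ t, (m t : ℝ≥0∞) ^ (q - 1) ∂ν := by
    have hp : ENNReal.ofReal p * ENNReal.ofReal (q - 1) = ENNReal.ofReal q := by
      rw [← ENNReal.ofReal_mul hpq.nonneg]
      congr 1
      have := hpq.symm.mul_eq_add
      linarith
    rw [l1, l2, ← mul_assoc, hp]
    gcongr 1
    refine setLIntegral_mono' measurableSet_Ioi fun c hc => ?_
    have hc : 0 < c := hc
    have h1 : c ^ (q - 1) = c * c ^ (q - 1 - 1) := by
      rw [Real.rpow_sub_one hc.ne' (q - 1)]; field_simp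
    rw [h1, ENNReal.ofReal_mul hc.le, ← mul_assoc]
    gcongr
    rw [mul_comm, hν, withDensity_apply _ (hms c)]
    exact hw c hc
  have hν2 : ∫⁻ t, (m t : ℝ≥0∞) ^ (q - 1) ∂ν = ∫⁻ t, g t * (m t : ℝ≥0∞) ^ (q - 1) ∂μ := by
    rw [hν, lintegral_withDensity_eq_lintegral_mul _ (by fun_prop) (by fun_prop)]
    rfl
  have hold := ENNReal.lintegral_mul_le_Lp_mul_Lq μ hpq.symm (f := fun t => (g t : ℝ≥0∞))
    (g := fun t => (m t : ℝ≥0∞) ^ (q - 1)) (by fun_prop) (by fun_prop)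
  have hexp : ∀ t, ((m t : ℝ≥0∞) ^ (q - 1)) ^ p = (m t : ℝ≥0∞) ^ q := by
    intro t
    rw [← ENNReal.rpow_mul]
    congr 1
    have := hpq.symm.mul_eq_add
    linarith
  simp only [hexp, Pi.mul_apply] at hold
  set I := ∫⁻ t, (m t : ℝ≥0∞) ^ q ∂μ with hI
  set A := ∫⁻ t, (g t : ℝ≥0∞) ^ q ∂μ with hA
  -- Hölder will bound `I` by a power of itself; cancelling that power requires finiteness, which
  -- the bound on `m` and the finite measure provide.
  have hfin : I ≠ ⊤ := by
    refine ne_top_of_le_ne_top (b := ∫⁻ _, (C : ℝ≥0∞) ^ q ∂μ) ?_ (lintegral_mono fun t => ?_)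
    · rw [lintegral_const]
      exact ENNReal.mul_ne_top (ENNReal.rpow_ne_top_of_nonneg hq0.le ENNReal.coe_ne_top)
        (measure_ne_top _ _)
    · exact ENNReal.rpow_le_rpow (ENNReal.coe_le_coe.2 (hC t)) hq0.le
  have h1 : I ≤ (ENNReal.ofReal p ^ q * A) ^ (1 / q) * (1 * I) ^ (1 / p) := by
    refine hle.trans ?_
    rw [hν2, ENNReal.mul_rpow_of_nonneg _ _ (by positivity), ← ENNReal.rpow_mul,
      mul_one_div_cancel hq0.ne', ENNReal.rpow_one, one_mul, mul_assoc]
    gcongr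
  simpa using le_of_le_rpow_mul_rpow hpq.symm hfin h1

/-- The one-sided maximal inequality. -/
theorem lintegral_leftMax_rpow_le {F : Finset ℝ} {g : ℝ → ℝ≥0} (hg : Measurable g) {C : ℝ≥0}
    (hC : ∀ t, g t ≤ C) {a T : ℝ} (haF : ∀ r ∈ F, a ≤ r) {p q : ℝ} (hpq : p.HolderConjugate q) :
    ∫⁻ t in Ioc a T, (leftMax F g t : ℝ≥0∞) ^ q ≤
      ENNReal.ofReal p ^ q * ∫⁻ t, (g t : ℝ≥0∞) ^ q := by
  refine (lintegral_rpow_le_of_weakType _ (measurable_leftMax hg hC) hg (leftMax_le hC)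
    (fun c hc => mul_measure_lt_leftMax_le hg hC haF hc) hpq).trans ?_
  gcongr
  exact Measure.restrict_le_self

theorem integral_le_leftMax_mul {F : Finset ℝ} {g : ℝ → ℝ≥0} {r t : ℝ} (hr : r ∈ F) (h : r < t) :
    ∫ x in r..t, (g x : ℝ) ≤ leftMax F g t * (t - r) := by
  by_contra hlt
  exact lt_irrefl _ ((lt_leftMax_iff (leftMax F g t).coe_nonneg).2 ⟨r, hr, h, not_le.1 hlt⟩)

/-- Reflection in the origin turns averages to the right of `t` into averages to the left of `-t`;
it swaps the half-open ends of the interval, which is a null change. -/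
theorem lintegral_leftMax_neg_rpow_le {F : Finset ℝ} {g : ℝ → ℝ≥0} (hg : Measurable g) {C : ℝ≥0}
    (hC : ∀ t, g t ≤ C) {T : ℝ} (haF : ∀ r ∈ F, -T ≤ r) {p q : ℝ} (hpq : p.HolderConjugate q) :
    ∫⁻ t in Ioc (-T) T, (leftMax F (fun x => g (-x)) (-t) : ℝ≥0∞) ^ q ≤
      ENNReal.ofReal p ^ q * ∫⁻ t, (g t : ℝ≥0∞) ^ q := by
  have hneg : MeasurePreserving (fun x : ℝ => -x) volume volume :=
    Measure.measurePreserving_neg volume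
  have hm : Measurable fun t => (leftMax F (fun x => g (-x)) t : ℝ≥0∞) ^ q :=
    ((measurable_leftMax (hg.comp measurable_neg) fun t => hC _).coe_nnreal_ennreal).pow_const q
  have h1 := hneg.setLIntegral_comp_preimage (s := Ico (-T) T) measurableSet_Ico hm
  have h2 : (fun x : ℝ => -x) ⁻¹' Ico (-T) T = Ioc (-T) T := by
    ext x; simp only [mem_preimage, mem_Ico, mem_Ioc]; constructor <;> rintro ⟨_, _⟩ <;>
      constructor <;> linarith
  rw [h2, setLIntegral_congr (Ico_ae_eq_Ioc (a := -T) (b := T) (μ := volume))] at h1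
  rw [h1]
  refine (lintegral_leftMax_rpow_le (hg.comp measurable_neg) (fun t => hC _) haF hpq).trans ?_
  have h3 := hneg.lintegral_comp (f := fun t => (g t : ℝ≥0∞) ^ q) (by fun_prop)
  simp only [Function.comp_apply]
  rw [h3]

/-! ### Competitiveness of Average Rate -/

theorem Job.duration_pos (j : Job) : 0 < j.deadline - j.release :=
  sub_pos.2 j.release_lt_deadline

/-- The density of a job: its work divided by its duration. -/
noncomputable def Job.density (j : Job) : ℝ≥0 := j.work / (j.deadline - j.release).toNNReal

/-- The total density of the jobs that are alive at time `t`: the speed of the algorithm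
*Average Rate*. -/
noncomputable def averageRate (J : JobSet) (t : ℝ) : ℝ≥0 :=
  ∑ j ∈ J, (Icc j.release j.deadline).indicator (fun _ => j.density) t

theorem measurable_averageRate (J : JobSet) : Measurable (averageRate J) := by
  unfold averageRate
  exact Finset.measurable_fun_sum _ fun j _ => measurable_const.indicator measurableSet_Icc

theorem averageRate_le (J : JobSet) (t : ℝ) : averageRate J t ≤ ∑ j ∈ J, j.density :=
  Finset.sum_le_sum fun _ _ => indicator_le_self' (fun _ _ => zero_le) t

theorem Job.density_mul (j : Job) :
    (j.density : ℝ≥0∞) * ENNReal.ofReal (j.deadline - j.release) = j.work := by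
  rw [ENNReal.ofReal, ← ENNReal.coe_mul, Job.density, div_mul_cancel₀]
  exact (Real.toNNReal_pos.2 j.duration_pos).ne'

theorem exists_bound_times (J : JobSet) :
    ∃ T : ℝ, ∀ j ∈ J, -T ≤ j.release ∧ j.deadline ≤ T := by
  refine ⟨∑ j ∈ J, |j.deadline|, fun j hj => ?_⟩
  have h := Finset.single_le_sum (f := fun j : Job => |j.deadline|) (fun _ _ => abs_nonneg _) hj
  constructor
  · have := j.release_nonneg; have := abs_nonneg j.deadline; linarith
  · exact (le_abs_self _).trans h

/-- Allows this integral to be cancelled when it is bounded in terms of a power of itself. -/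
theorem lintegral_averageRate_rpow_ne_top (J : JobSet) {α : ℝ} (hα : 0 < α) :
    ∫⁻ t, (averageRate J t : ℝ≥0∞) ^ α ≠ ⊤ := by
  obtain ⟨T, hT⟩ := exists_bound_times J
  refine ne_top_of_le_ne_top (b := ∫⁻ t, (Icc (-T) T).indicator
    (fun _ => ((∑ j ∈ J, j.density : ℝ≥0) : ℝ≥0∞) ^ α) t) ?_ (lintegral_mono fun t => ?_)
  · rw [lintegral_indicator measurableSet_Icc, lintegral_const]
    refine ENNReal.mul_ne_top (ENNReal.rpow_ne_top_of_nonneg hα.le ENNReal.coe_ne_top) ?_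
    simp
  · by_cases ht : t ∈ Icc (-T) T
    · rw [indicator_of_mem ht]
      exact ENNReal.rpow_le_rpow (ENNReal.coe_le_coe.2 (averageRate_le J t)) hα.le
    · rw [indicator_of_notMem ht]
      have : averageRate J t = 0 := Finset.sum_eq_zero fun j hj => indicator_of_notMem
        (fun h => ht ⟨(hT j hj).1.trans h.1, h.2.trans (hT j hj).2⟩) _
      simp [this, hα]

/-- The average of `g` over the lifetime of a job is at most the larger one of the two one-sided
maximal functions of `g`. -/
theorem lintegral_le_max_leftMax_mul {g : ℝ → ℝ≥0} (hg : Measurable g) {C : ℝ≥0}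
    (hC : ∀ t, g t ≤ C) {F F' : Finset ℝ} {r d t : ℝ} (hr : r ∈ F) (hd : -d ∈ F') (hrt : r < t)
    (htd : t < d) :
    ∫⁻ x in Icc r d, (g x : ℝ≥0∞) ≤
      max (leftMax F g t : ℝ≥0∞) (leftMax F' (fun x => g (-x)) (-t)) * ENNReal.ofReal (d - r) := by
  have h1 := integral_le_leftMax_mul (g := g) hr hrt
  have h2 := integral_le_leftMax_mul (g := fun x => g (-x)) hd (neg_lt_neg htd)
  rw [intervalIntegral.integral_comp_neg (fun x => (g x : ℝ)), neg_neg, neg_neg] at h2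
  have hI := intervalIntegrable_of_bdd hg hC
  have h3 := intervalIntegral.integral_add_adjacent_intervals (hI r t) (hI t d)
  set L : ℝ≥0 := leftMax F g t
  set R : ℝ≥0 := leftMax F' (fun x => g (-x)) (-t)
  have h4 : ∫ x in r..d, (g x : ℝ) ≤ (max L R : ℝ≥0) * (d - r) := by
    have e1 : (L : ℝ) ≤ (max L R : ℝ≥0) := NNReal.coe_le_coe.2 (le_max_left _ _)
    have e2 : (R : ℝ) ≤ (max L R : ℝ≥0) := NNReal.coe_le_coe.2 (le_max_right _ _)
    nlinarith
  have h5 : ∫⁻ x in Icc r d, (g x : ℝ≥0∞) = ENNReal.ofReal (∫ x in r..d, (g x : ℝ)) := by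
    rw [intervalIntegral.integral_of_le (hrt.trans htd).le, ofReal_integral_eq_lintegral_ofReal
      ((intervalIntegrable_iff_integrableOn_Ioc_of_le (hrt.trans htd).le).1 (hI r d))
      (Eventually.of_forall fun x => (g x).coe_nonneg),
      setLIntegral_congr (Ioc_ae_eq_Icc (a := r) (b := d) (μ := volume))]
    simp
  rw [h5]
  refine (ENNReal.ofReal_le_ofReal h4).trans (le_of_eq ?_)
  rw [ENNReal.ofReal_mul NNReal.zero_le_coe, ENNReal.ofReal_coe_nnreal, ENNReal.coe_max]

/-- *Average Rate* is `(2α)^α / 2`-competitive. -/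
theorem lintegral_averageRate_rpow_le {α : ℝ} (hα : 1 < α) {J : JobSet} {s : Schedule}
    (hs : Feasible J s) :
    ∫⁻ t, (averageRate J t : ℝ≥0∞) ^ α ≤ ENNReal.ofReal ((2 * α) ^ α / 2) * cost α J s := by
  classical
  obtain ⟨T, hT⟩ := exists_bound_times J
  set q := α.conjExponent with hq
  have hpq : α.HolderConjugate q := Real.HolderConjugate.conjExponent hα
  have hα0 : 0 < α := hpq.pos
  have hq0 : 0 < q := hpq.symm.pos
  have hBm := measurable_averageRate J
  -- The test function dual to the average rate: its q-th power is the integrand of `X`, because `(α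
  -- - 1) q = α`.
  set g : ℝ → ℝ≥0 := fun t => averageRate J t ^ (α - 1) with hg
  have hgm : Measurable g := hBm.pow_const _
  have hgC : ∀ t, g t ≤ (∑ j ∈ J, j.density) ^ (α - 1) := fun t =>
    NNReal.rpow_le_rpow (averageRate_le J t) (sub_pos.2 hα).le
  have hgq : ∀ t, (g t : ℝ≥0∞) ^ q = (averageRate J t : ℝ≥0∞) ^ α := fun t => by
    rw [hg, ENNReal.coe_rpow_of_nonneg _ (sub_pos.2 hα).le, ← ENNReal.rpow_mul]
    congr 1
    have := hpq.mul_eq_add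
    linarith
  set X := ∫⁻ t, (averageRate J t : ℝ≥0∞) ^ α with hX
  have hXt : X ≠ ⊤ := lintegral_averageRate_rpow_ne_top J hα0
  set L := fun t => (leftMax (J.image Job.release) g t : ℝ≥0∞) with hL
  set R := fun t => (leftMax (J.image fun j => -j.deadline) (fun x => g (-x)) (-t) : ℝ≥0∞) with hR
  have hLm : Measurable L := (measurable_leftMax hgm hgC).coe_nnreal_ennreal
  have hRm : Measurable R := ((measurable_leftMax (hgm.comp measurable_neg)
    fun t => hgC _).comp measurable_neg).coe_nnreal_ennreal
  have hLq : ∫⁻ t in Ioc (-T) T, L t ^ q ≤ ENNReal.ofReal α ^ q * X := by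
    have := lintegral_leftMax_rpow_le hgm hgC (F := J.image Job.release) (a := -T) (T := T)
      (fun r hr => by
        obtain ⟨j, hj, rfl⟩ := Finset.mem_image.1 hr
        exact (hT j hj).1) hpq
    simpa only [hgq] using this
  have hRq : ∫⁻ t in Ioc (-T) T, R t ^ q ≤ ENNReal.ofReal α ^ q * X := by
    have := lintegral_leftMax_neg_rpow_le hgm hgC (F := J.image fun j => -j.deadline) (T := T)
      (fun r hr => by
        obtain ⟨j, hj, rfl⟩ := Finset.mem_image.1 hr
        exact neg_le_neg (hT j hj).2) hpq
    simpa only [hgq] using this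
  have hmaxq : ∫⁻ t in Ioc (-T) T, max (L t) (R t) ^ q ≤ 2 * ENNReal.ofReal α ^ q * X := by
    calc ∫⁻ t in Ioc (-T) T, max (L t) (R t) ^ q
        ≤ ∫⁻ t in Ioc (-T) T, (L t ^ q + R t ^ q) := by
          refine lintegral_mono fun t => ?_
          rcases max_choice (L t) (R t) with h | h <;> rw [h]
          · exact le_self_add
          · exact le_add_self
      _ = (∫⁻ t in Ioc (-T) T, L t ^ q) + ∫⁻ t in Ioc (-T) T, R t ^ q :=
          lintegral_add_left (hLm.pow_const q) _
      _ ≤ _ := by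
          refine (add_le_add hLq hRq).trans (le_of_eq ?_)
          ring
  have hXJ : X = ∑ j ∈ J, j.density * ∫⁻ t in Icc j.release j.deadline, (g t : ℝ≥0∞) := by
    have : ∀ t, (averageRate J t : ℝ≥0∞) ^ α =
        ∑ j ∈ J, (Icc j.release j.deadline).indicator (fun t => (j.density : ℝ≥0∞) * g t) t := by
      intro t
      have h1 : (averageRate J t : ℝ≥0∞) ^ α = averageRate J t * g t := by
        rw [hg, ENNReal.coe_rpow_of_nonneg _ (sub_pos.2 hα).le]
        nth_rewrite 2 [← ENNReal.rpow_one (averageRate J t : ℝ≥0∞)]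
        rw [← ENNReal.rpow_add_of_nonneg _ _ zero_le_one (sub_pos.2 hα).le, add_sub_cancel]
      rw [h1, averageRate, ENNReal.ofNNReal_finsetSum, Finset.sum_mul]
      refine Finset.sum_congr rfl fun j _ => ?_
      by_cases ht : t ∈ Icc j.release j.deadline
      · simp only [indicator_of_mem ht]
      · simp only [indicator_of_notMem ht, ENNReal.coe_zero, zero_mul]
    rw [hX]
    simp only [this]
    rw [lintegral_finsetSum _ fun j _ => (by fun_prop : Measurable fun t =>
      (j.density : ℝ≥0∞) * g t).indicator measurableSet_Icc]
    refine Finset.sum_congr rfl fun j _ => ?_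
    rw [lintegral_indicator measurableSet_Icc, lintegral_const_mul _ (by fun_prop)]
  -- The left side is the work times the mean of `g` over the lifetime. This mean is dominated by
  -- `max (L u) (R u)` at every interior time `u`, so it may be charged wherever `s` processes the
  -- job.
  have hjob : ∀ j ∈ J, j.density * ∫⁻ t in Icc j.release j.deadline, (g t : ℝ≥0∞) ≤
      ∫⁻ t in Ioc (-T) T, s j t * max (L t) (R t) := by
    intro j hj
    obtain ⟨hm, h0, hw⟩ := hs j hj
    have hD : ENNReal.ofReal (j.deadline - j.release) ≠ 0 := by simp [j.release_lt_deadline]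
    calc j.density * ∫⁻ t in Icc j.release j.deadline, (g t : ℝ≥0∞)
        = ∫⁻ u in Icc j.release j.deadline, s j u *
            ((∫⁻ t in Icc j.release j.deadline, (g t : ℝ≥0∞)) /
              ENNReal.ofReal (j.deadline - j.release)) := by
          rw [lintegral_mul_const _ (by fun_prop), hw, ← j.density_mul, mul_assoc,
            ENNReal.mul_div_cancel hD ENNReal.ofReal_ne_top]
      _ = ∫⁻ u in Ioo j.release j.deadline, s j u *
            ((∫⁻ t in Icc j.release j.deadline, (g t : ℝ≥0∞)) /
              ENNReal.ofReal (j.deadline - j.release)) :=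
          (setLIntegral_congr Ioo_ae_eq_Icc).symm
      _ ≤ ∫⁻ u in Ioo j.release j.deadline, s j u * max (L u) (R u) := by
          refine setLIntegral_mono' measurableSet_Ioo fun u hu => ?_
          gcongr
          refine ENNReal.div_le_of_le_mul ?_
          exact lintegral_le_max_leftMax_mul hgm hgC (Finset.mem_image_of_mem _ hj)
            (Finset.mem_image_of_mem (fun j : Job => -j.deadline) hj) hu.1 hu.2
      _ ≤ ∫⁻ t in Ioc (-T) T, s j t * max (L t) (R t) := lintegral_mono_set fun u hu =>
          ⟨(hT j hj).1.trans_lt hu.1, hu.2.le.trans (hT j hj).2⟩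
  have hmain : X ≤ cost α J s ^ (1 / α) * (2 * ENNReal.ofReal α ^ q * X) ^ (1 / q) := by
    calc X ≤ ∑ j ∈ J, ∫⁻ t in Ioc (-T) T, s j t * max (L t) (R t) :=
          hXJ.trans_le (Finset.sum_le_sum hjob)
      _ = ∫⁻ t in Ioc (-T) T, ∑ j ∈ J, s j t * max (L t) (R t) :=
          (lintegral_finsetSum _ fun j hj =>
            (hs j hj).1.coe_nnreal_ennreal.mul (hLm.max hRm)).symm
      _ = ∫⁻ t in Ioc (-T) T, ((fun t => ((∑ j ∈ J, s j t : ℝ≥0) : ℝ≥0∞)) *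
            fun t => max (L t) (R t)) t := by
          refine lintegral_congr fun t => ?_
          rw [Pi.mul_apply, ENNReal.ofNNReal_finsetSum, Finset.sum_mul]
      _ ≤ _ := ENNReal.lintegral_mul_le_Lp_mul_Lq _ hpq
            ((Finset.measurable_fun_sum _ fun j hj => (hs j hj).1).coe_nnreal_ennreal.aemeasurable)
            (hLm.max hRm).aemeasurable
      _ ≤ _ := by
          gcongr
          exact setLIntegral_le_lintegral _ _
  refine (le_of_le_rpow_mul_rpow hpq hXt hmain).trans (le_of_eq ?_)
  congr 1
  have hqα' : q * (α - 1) = α := by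
    have := hpq.mul_eq_add
    linarith
  rw [ENNReal.mul_rpow_of_nonneg _ _ (sub_pos.2 hα).le, ← ENNReal.rpow_mul, hqα',
    show (2 : ℝ≥0∞) = ENNReal.ofReal 2 by simp, ENNReal.ofReal_rpow_of_pos two_pos,
    ENNReal.ofReal_rpow_of_pos hα0, ← ENNReal.ofReal_mul (by positivity),
    Real.mul_rpow two_pos.le hα0.le, Real.rpow_sub_one two_ne_zero]
  congr 1
  ring

/-! ### Decomposing speeds into levels -/

/-- The derivative of `x ^ α`, as a weight on the levels `x ≥ 0`. -/
noncomputable def levelWeight (α x : ℝ) : ℝ≥0∞ := ENNReal.ofReal (α * x ^ (α - 1))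

theorem measurable_levelWeight (α : ℝ) : Measurable (levelWeight α) := by
  unfold levelWeight
  fun_prop

theorem lintegral_levelWeight {α : ℝ} (hα : 1 ≤ α) {a b : ℝ≥0} (hab : a ≤ b) :
    ∫⁻ x in Ioc (a : ℝ) b, levelWeight α x = (b : ℝ≥0∞) ^ α - (a : ℝ≥0∞) ^ α := by
  have hα0 : 0 ≤ α := zero_le_one.trans hα
  have hab' : (a : ℝ) ≤ b := hab
  have hint : IntervalIntegrable (fun x : ℝ => α * x ^ (α - 1)) volume a b :=
    (intervalIntegral.intervalIntegrable_rpow' (by linarith)).const_mul α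
  have h1 : ∫⁻ x in Ioc (a : ℝ) b, levelWeight α x =
      ENNReal.ofReal (∫ x in (a : ℝ)..b, α * x ^ (α - 1)) := by
    rw [intervalIntegral.integral_of_le hab', ofReal_integral_eq_lintegral_ofReal
      ((intervalIntegrable_iff_integrableOn_Ioc_of_le hab').1 hint)]
    · rfl
    · refine (ae_restrict_iff' measurableSet_Ioc).2 (Eventually.of_forall fun x hx => ?_)
      have : 0 < x := a.coe_nonneg.trans_lt hx.1
      positivity
  rw [h1, intervalIntegral.integral_const_mul, integral_rpow (Or.inl (by linarith)), sub_add_cancel,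
    mul_div_cancel₀ _ (by linarith : α ≠ 0),
    ENNReal.ofReal_sub _ (Real.rpow_nonneg a.coe_nonneg _),
    ← ENNReal.ofReal_rpow_of_nonneg a.coe_nonneg hα0,
    ← ENNReal.ofReal_rpow_of_nonneg b.coe_nonneg hα0, ENNReal.ofReal_coe_nnreal,
    ENNReal.ofReal_coe_nnreal]

theorem levelWeight_mono {α : ℝ} (hα : 1 ≤ α) {x y : ℝ} (hx : 0 ≤ x) (hxy : x ≤ y) :
    levelWeight α x ≤ levelWeight α y := by
  unfold levelWeight
  have : 0 ≤ α - 1 := sub_nonneg.2 hα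
  gcongr

/-- Among all functions on the levels that are bounded by `M` and have the same integral, the
weighted integral is smallest if the lowest levels are filled. -/
theorem rpow_lintegral_le_of_le {α : ℝ} (hα : 1 ≤ α) {φ : ℝ → ℝ≥0∞} (hφ : Measurable φ) {M : ℝ≥0}
    (hM0 : M ≠ 0) (hM : ∀ x, 0 < x → φ x ≤ M) (hfin : ∫⁻ x in Ioi 0, φ x ≠ ⊤) :
    (∫⁻ x in Ioi 0, φ x) ^ α ≤ (M : ℝ≥0∞) ^ (α - 1) * ∫⁻ x in Ioi 0, levelWeight α x * φ x := by
  have hα0 : 0 ≤ α := zero_le_one.trans hα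
  have hwm := measurable_levelWeight α
  obtain ⟨Y, hY⟩ : ∃ Y : ℝ≥0, ∫⁻ x in Ioi 0, φ x = Y := ⟨_, (ENNReal.coe_toNNReal hfin).symm⟩
  -- Filling every level up to `c` to the maximum `M` uses exactly the mass of `φ`.
  set c : ℝ≥0 := Y / M with hc
  have hYc : (Y : ℝ≥0∞) = M * c := by
    rw [← ENNReal.coe_mul, hc, mul_div_cancel₀ _ hM0]
  have hsplit : ∀ f : ℝ → ℝ≥0∞, ∫⁻ x in Ioi 0, f x =
      (∫⁻ x in Ioc 0 (c : ℝ), f x) + ∫⁻ x in Ioi (c : ℝ), f x := by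
    intro f
    rw [← Ioc_union_Ioi_eq_Ioi c.coe_nonneg, lintegral_union measurableSet_Ioi
      (Set.disjoint_left.2 fun x hx hx' => not_lt.2 hx.2 hx')]
  have hw0 : ∫⁻ x in Ioc 0 (c : ℝ), levelWeight α x = (c : ℝ≥0∞) ^ α := by
    have := lintegral_levelWeight hα (zero_le (a := c))
    rw [NNReal.coe_zero] at this
    rw [this, ENNReal.coe_zero, ENNReal.zero_rpow_of_pos (by linarith), tsub_zero]
  have hadd : ∀ x ∈ Ioc 0 (c : ℝ), φ x + (M - φ x) = M := fun x hx =>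
    add_tsub_cancel_of_le (hM x hx.1)
  -- The mass missing below `c` equals the mass above `c`; since the weight is increasing, moving it
  -- down only lowers the weighted integral.
  have hgap : ∫⁻ x in Ioc 0 (c : ℝ), (M - φ x) = ∫⁻ x in Ioi (c : ℝ), φ x := by
    have h1 : (∫⁻ x in Ioc 0 (c : ℝ), φ x) + ∫⁻ x in Ioc 0 (c : ℝ), (M - φ x) = Y := by
      rw [← lintegral_add_left hφ, setLIntegral_congr_fun measurableSet_Ioc hadd, hYc]
      simp
    have h2 := hsplit φ
    rw [hY, ← h1] at h2
    refine (ENNReal.add_right_inj ?_).1 h2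
    exact ne_top_of_le_ne_top hfin (lintegral_mono_set Ioc_subset_Ioi_self)
  have hmain : (M : ℝ≥0∞) * (c : ℝ≥0∞) ^ α ≤ ∫⁻ x in Ioi 0, levelWeight α x * φ x := by
    calc (M : ℝ≥0∞) * (c : ℝ≥0∞) ^ α
        = ∫⁻ x in Ioc 0 (c : ℝ), levelWeight α x * M := by
          rw [lintegral_mul_const _ hwm, hw0, mul_comm]
      _ = ∫⁻ x in Ioc 0 (c : ℝ), (levelWeight α x * φ x + levelWeight α x * (M - φ x)) :=
          setLIntegral_congr_fun measurableSet_Ioc fun x hx => by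
            simp only [← mul_add, hadd x hx]
      _ = (∫⁻ x in Ioc 0 (c : ℝ), levelWeight α x * φ x) +
            ∫⁻ x in Ioc 0 (c : ℝ), levelWeight α x * (M - φ x) :=
          lintegral_add_left (hwm.mul hφ) _
      _ ≤ (∫⁻ x in Ioc 0 (c : ℝ), levelWeight α x * φ x) +
            ∫⁻ x in Ioc 0 (c : ℝ), levelWeight α c * (M - φ x) := by
          gcongr 1
          refine setLIntegral_mono' measurableSet_Ioc fun x hx => ?_
          gcongr
          exact levelWeight_mono hα hx.1.le hx.2
      _ = (∫⁻ x in Ioc 0 (c : ℝ), levelWeight α x * φ x) +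
            ∫⁻ x in Ioi (c : ℝ), levelWeight α c * φ x := by
          rw [lintegral_const_mul _ (by fun_prop), hgap, lintegral_const_mul _ hφ]
      _ ≤ (∫⁻ x in Ioc 0 (c : ℝ), levelWeight α x * φ x) +
            ∫⁻ x in Ioi (c : ℝ), levelWeight α x * φ x := by
          gcongr 1
          refine setLIntegral_mono' measurableSet_Ioi fun x hx => ?_
          gcongr
          exact levelWeight_mono hα c.coe_nonneg (mem_Ioi.1 hx).le
      _ = _ := (hsplit _).symm
  rw [hY, hYc, ENNReal.mul_rpow_of_nonneg _ _ hα0]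
  have hM1 : (M : ℝ≥0∞) ^ α = (M : ℝ≥0∞) ^ (α - 1) * M := by
    nth_rewrite 3 [← ENNReal.rpow_one (M : ℝ≥0∞)]
    rw [← ENNReal.rpow_add_of_nonneg _ _ (sub_nonneg.2 hα) zero_le_one, sub_add_cancel]
  rw [hM1, mul_assoc]
  gcongr

/-- Tonelli: integrating over the levels first, each layer `[a ω, b ω)` contributes the total weight
of its levels. -/
theorem lintegral_levelWeight_mul_measure {Ω : Type*} [MeasurableSpace Ω] (ν : Measure Ω)
    [SFinite ν] {a b : Ω → ℝ≥0} (ha : Measurable a) (hb : Measurable b) (hab : ∀ ω, a ω ≤ b ω)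
    {α : ℝ} (hα : 1 ≤ α) :
    ∫⁻ x in Ioi 0, levelWeight α x * ν {ω | (a ω : ℝ) ≤ x ∧ x < b ω} =
      ∫⁻ ω, ((b ω : ℝ≥0∞) ^ α - (a ω : ℝ≥0∞) ^ α) ∂ν := by
  have hms : MeasurableSet {p : ℝ × Ω | (a p.2 : ℝ) ≤ p.1 ∧ p.1 < b p.2} :=
    (measurableSet_le (by fun_prop) measurable_fst).inter
      (measurableSet_lt measurable_fst (by fun_prop))
  have hwm := measurable_levelWeight α
  calc ∫⁻ x in Ioi 0, levelWeight α x * ν {ω | (a ω : ℝ) ≤ x ∧ x < b ω}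
      = ∫⁻ x in Ioi 0, ∫⁻ ω, {p : ℝ × Ω | (a p.2 : ℝ) ≤ p.1 ∧ p.1 < b p.2}.indicator
          (fun p => levelWeight α p.1) (x, ω) ∂ν := by
        refine lintegral_congr fun x => ?_
        have : ∀ ω, {p : ℝ × Ω | (a p.2 : ℝ) ≤ p.1 ∧ p.1 < b p.2}.indicator
            (fun p => levelWeight α p.1) (x, ω) =
            {ω | (a ω : ℝ) ≤ x ∧ x < b ω}.indicator (fun _ => levelWeight α x) ω := fun ω => rfl
        simp only [this]
        have hmx : MeasurableSet {ω | (a ω : ℝ) ≤ x ∧ x < b ω} := measurable_prodMk_left hms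
        rw [lintegral_indicator hmx, lintegral_const, Measure.restrict_apply_univ]
    _ = ∫⁻ ω, (∫⁻ x in Ioi 0, {p : ℝ × Ω | (a p.2 : ℝ) ≤ p.1 ∧ p.1 < b p.2}.indicator
          (fun p => levelWeight α p.1) (x, ω)) ∂ν :=
        lintegral_lintegral_swap ((hwm.comp measurable_fst).indicator hms).aemeasurable
    _ = _ := by
        refine lintegral_congr fun ω => ?_
        have : ∀ x, {p : ℝ × Ω | (a p.2 : ℝ) ≤ p.1 ∧ p.1 < b p.2}.indicator
            (fun p => levelWeight α p.1) (x, ω) =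
            (Ico (a ω : ℝ) (b ω)).indicator (levelWeight α) x := fun x => rfl
        simp only [this]
        rw [← lintegral_levelWeight hα (hab ω), setLIntegral_congr (Ioi_ae_eq_Ici (a := (0 : ℝ))),
          lintegral_indicator measurableSet_Ico, Measure.restrict_restrict measurableSet_Ico,
          inter_eq_self_of_subset_left fun x hx => mem_Ici.2 ((a ω).coe_nonneg.trans hx.1),
          setLIntegral_congr Ico_ae_eq_Ioc]

/-- A speed that is composed of layers `[a, b)` at arbitrary levels, no level being used more
than `M` times, is dominated by the costs of its layers. -/
theorem rpow_add_lintegral_le {Ω : Type*} [MeasurableSpace Ω] (ν : Measure Ω)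
    [SFinite ν] {a b : Ω → ℝ≥0} (ha : Measurable a) (hb : Measurable b) (hab : ∀ ω, a ω ≤ b ω)
    {α : ℝ} (hα : 1 ≤ α) (y : ℝ≥0) {M : ℝ≥0}
    (hM : ∀ x : ℝ, 0 < x → 1 + ν {ω | (a ω : ℝ) ≤ x ∧ x < b ω} ≤ M)
    (hfin : ∫⁻ ω, ((b ω : ℝ≥0∞) - a ω) ∂ν ≠ ⊤) :
    ((y : ℝ≥0∞) + ∫⁻ ω, ((b ω : ℝ≥0∞) - a ω) ∂ν) ^ α ≤ (M : ℝ≥0∞) ^ (α - 1) *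
      ((y : ℝ≥0∞) ^ α + ∫⁻ ω, ((b ω : ℝ≥0∞) ^ α - (a ω : ℝ≥0∞) ^ α) ∂ν) := by
  have hwm := measurable_levelWeight
  have hms : MeasurableSet {p : ℝ × Ω | (a p.2 : ℝ) ≤ p.1 ∧ p.1 < b p.2} :=
    (measurableSet_le (by fun_prop) measurable_fst).inter
      (measurableSet_lt measurable_fst (by fun_prop))
  have hνm : Measurable fun x : ℝ => ν {ω | (a ω : ℝ) ≤ x ∧ x < b ω} :=
    measurable_measure_prodMk_left hms
  have him : Measurable ((Ioc (0 : ℝ) y).indicator (1 : ℝ → ℝ≥0∞)) :=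
    measurable_one.indicator measurableSet_Ioc
  -- `φ x` measures how often level `x` is used: once by the base speed if `x ≤ y`, and by the
  -- layers that contain it.
  set φ : ℝ → ℝ≥0∞ := fun x =>
    (Ioc (0 : ℝ) y).indicator 1 x + ν {ω | (a ω : ℝ) ≤ x ∧ x < b ω} with hφ
  -- The exponent `β = 1` recovers the speed itself, `β = α` the weighted cost of its layers.
  have key : ∀ β : ℝ, 1 ≤ β → ∫⁻ x in Ioi 0, levelWeight β x * φ x =
      (y : ℝ≥0∞) ^ β + ∫⁻ ω, ((b ω : ℝ≥0∞) ^ β - (a ω : ℝ≥0∞) ^ β) ∂ν := by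
    intro β hβ
    simp only [hφ, mul_add]
    rw [lintegral_add_left (by fun_prop : Measurable fun x : ℝ =>
        levelWeight β x * (Ioc (0 : ℝ) y).indicator (1 : ℝ → ℝ≥0∞) x),
      lintegral_levelWeight_mul_measure ν ha hb hab hβ]
    congr 1
    have : ∀ x, levelWeight β x * (Ioc (0 : ℝ) y).indicator 1 x =
        (Ioc (0 : ℝ) y).indicator (levelWeight β) x := by
      intro x
      by_cases hx : x ∈ Ioc (0 : ℝ) y <;> simp [hx]
    simp only [this]
    have h0 := lintegral_levelWeight hβ (zero_le (a := y))
    rw [NNReal.coe_zero, ENNReal.coe_zero, ENNReal.zero_rpow_of_pos (by linarith), tsub_zero] at h0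
    rw [lintegral_indicator measurableSet_Ioc, Measure.restrict_restrict measurableSet_Ioc,
      inter_eq_self_of_subset_left Ioc_subset_Ioi_self, h0]
  have key1 : ∫⁻ x in Ioi 0, φ x = (y : ℝ≥0∞) + ∫⁻ ω, ((b ω : ℝ≥0∞) - a ω) ∂ν := by
    have := key 1 le_rfl
    simpa [levelWeight] using this
  rw [← key1, ← key α hα]
  refine rpow_lintegral_le_of_le hα (him.add hνm) ?_ (fun x hx => ?_) ?_
  · rintro rfl
    have := hM 1 one_pos
    simp at this
  · refine le_trans ?_ (hM x hx)
    exact add_le_add (indicator_le_self' (fun _ _ => zero_le) x) le_rfl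
  · change ∫⁻ x in Ioi 0, φ x ≠ ⊤
    rw [key1]
    exact ENNReal.add_ne_top.2 ⟨ENNReal.coe_ne_top, hfin⟩

/-! ### Sliding windows and the robust schedule -/

/-- `∫ f(u) du` over `u ∈ [t - L, t]`. -/
noncomputable def window (L : ℝ) (f : ℝ → ℝ≥0∞) (t : ℝ) : ℝ≥0∞ :=
  ∫⁻ u in Icc (t - L) t, f u

theorem measurableSet_window (L : ℝ) : MeasurableSet {p : ℝ × ℝ | p.2 ∈ Icc (p.1 - L) p.1} :=
  (measurableSet_le (by fun_prop) measurable_snd).inter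
    (measurableSet_le measurable_snd measurable_fst)

theorem window_eq (L : ℝ) (f : ℝ → ℝ≥0∞) (t : ℝ) :
    window L f t =
      ∫⁻ u, {p : ℝ × ℝ | p.2 ∈ Icc (p.1 - L) p.1}.indicator (fun p => f p.2) (t, u) := by
  rw [window, ← lintegral_indicator measurableSet_Icc]
  rfl

theorem measurable_window (L : ℝ) {f : ℝ → ℝ≥0∞} (hf : Measurable f) :
    Measurable (window L f) := by
  simp only [funext (window_eq L f)]
  exact ((hf.comp measurable_snd).indicator (measurableSet_window L)).lintegral_prod_right'

/-- A time `u` lies in the windows of exactly the times in `[u, u + L]`. Hence averaging over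
windows conserves work. -/
theorem lintegral_window (L : ℝ) {f : ℝ → ℝ≥0∞} (hf : Measurable f) :
    ∫⁻ t, window L f t = ENNReal.ofReal L * ∫⁻ u, f u := by
  simp only [window_eq]
  have hm : Measurable (Function.uncurry fun t u : ℝ =>
      {p : ℝ × ℝ | p.2 ∈ Icc (p.1 - L) p.1}.indicator (fun p => f p.2) (t, u)) :=
    (hf.comp measurable_snd).indicator (measurableSet_window L)
  rw [lintegral_lintegral_swap hm.aemeasurable, ← lintegral_const_mul _ hf]
  refine lintegral_congr fun u => ?_
  have : ∀ t, {p : ℝ × ℝ | p.2 ∈ Icc (p.1 - L) p.1}.indicator (fun p => f p.2) (t, u) =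
      (Icc u (u + L)).indicator (fun _ => f u) t := by
    intro t
    have h : (t, u) ∈ {p : ℝ × ℝ | p.2 ∈ Icc (p.1 - L) p.1} ↔ t ∈ Icc u (u + L) := by
      simp only [mem_ofPred_eq, mem_Icc]
      constructor <;> rintro ⟨h1, h2⟩ <;> constructor <;> linarith
    by_cases ht : t ∈ Icc u (u + L)
    · rw [indicator_of_mem ht, indicator_of_mem (h.2 ht)]
    · rw [indicator_of_notMem ht, indicator_of_notMem (mt h.1 ht)]
  simp only [this]
  rw [lintegral_indicator measurableSet_Icc, lintegral_const, Measure.restrict_apply_univ,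
    Real.volume_Icc, add_sub_cancel_left, mul_comm]

theorem window_le (L : ℝ) (f : ℝ → ℝ≥0∞) (t : ℝ) : window L f t ≤ ∫⁻ u, f u :=
  setLIntegral_le_lintegral _ _

theorem window_eq_zero {L : ℝ} {f : ℝ → ℝ≥0∞} {t r e : ℝ} (hf : ∀ u, u ∉ Icc r e → f u = 0)
    (ht : t ∉ Icc r (e + L)) : window L f t = 0 := by
  refine setLIntegral_eq_zero measurableSet_Icc fun u hu => hf u fun h => ht ?_
  exact ⟨h.1.trans hu.2, by linarith [hu.1, h.2]⟩

section Robustify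

variable (δ : ℝ) (J : JobSet) (σ : Schedule)

/-- The total speed of the jobs of `J`. -/
noncomputable def totalSpeed (t : ℝ) : ℝ≥0 := ∑ j ∈ J, σ j t

/-- The total speed, capped at a multiple of the average rate. -/
noncomputable def cappedSpeed (t : ℝ) : ℝ≥0 :=
  min (totalSpeed J σ t) (((1 - δ) / δ ^ 2).toNNReal * averageRate J t)

/-- The share of a job in the total speed. -/
noncomputable def share (j : Job) (t : ℝ) : ℝ≥0 := σ j t / totalSpeed J σ t

/-- The part of the speed of a job that exceeds the cap. -/
noncomputable def deferred (j : Job) (t : ℝ) : ℝ≥0 :=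
  share J σ j t * (totalSpeed J σ t - cappedSpeed δ J σ t)

/-- The robust version of the schedule `σ` of the shrunk jobs: `σ` is followed as long as its
total speed does not exceed the cap, and the work that exceeds the cap is spread evenly over
the subsequent fraction `δ` of the duration of the job. -/
noncomputable def robustify (j : Job) (t : ℝ) : ℝ≥0 :=
  share J σ j t * cappedSpeed δ J σ t +
    (window (δ * (j.deadline - j.release)) (fun u => (deferred δ J σ j u : ℝ≥0∞)) t).toNNReal /
      (δ * (j.deadline - j.release)).toNNReal

/-- `σ` processes every job of `J` within the first fraction `1 - δ` of its duration. -/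
def FeasibleEarly : Prop :=
  ∀ j ∈ J, Measurable (σ j) ∧
    (∀ t, t ∉ Icc j.release (j.release + (1 - δ) * (j.deadline - j.release)) → σ j t = 0) ∧
    ∫⁻ t, (σ j t : ℝ≥0∞) = j.work

end Robustify

section

variable {δ : ℝ} {J : JobSet} {σ : Schedule}

theorem FeasibleEarly.measurable_totalSpeed (h : FeasibleEarly δ J σ) :
    Measurable (totalSpeed J σ) :=
  Finset.measurable_fun_sum _ fun j hj => (h j hj).1

theorem FeasibleEarly.measurable_cappedSpeed (h : FeasibleEarly δ J σ) :
    Measurable (cappedSpeed δ J σ) :=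
  h.measurable_totalSpeed.min ((measurable_averageRate J).const_mul _)

theorem FeasibleEarly.measurable_share (h : FeasibleEarly δ J σ) {j : Job} (hj : j ∈ J) :
    Measurable (share J σ j) :=
  (h j hj).1.div h.measurable_totalSpeed

theorem FeasibleEarly.measurable_deferred (h : FeasibleEarly δ J σ) {j : Job} (hj : j ∈ J) :
    Measurable (deferred δ J σ j) :=
  (h.measurable_share hj).mul (h.measurable_totalSpeed.sub h.measurable_cappedSpeed)

theorem cappedSpeed_le (t : ℝ) : cappedSpeed δ J σ t ≤ totalSpeed J σ t := min_le_left _ _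

theorem share_mul_totalSpeed {j : Job} (hj : j ∈ J) (t : ℝ) :
    share J σ j t * totalSpeed J σ t = σ j t := by
  rcases eq_or_ne (totalSpeed J σ t) 0 with h | h
  · rw [h, mul_zero]
    exact ((Finset.sum_eq_zero_iff.1 h) j hj).symm
  · rw [share, div_mul_cancel₀ _ h]

theorem share_mul_cappedSpeed_add_deferred {j : Job} (hj : j ∈ J) (t : ℝ) :
    share J σ j t * cappedSpeed δ J σ t + deferred δ J σ j t = σ j t := by
  rw [deferred, ← mul_add, add_tsub_cancel_of_le (cappedSpeed_le t), share_mul_totalSpeed hj]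

theorem sum_share_le_one (t : ℝ) : ∑ j ∈ J, share J σ j t ≤ 1 := by
  simp only [share]
  rw [← Finset.sum_div]
  exact div_self_le_one _

theorem sum_share_mul_cappedSpeed (t : ℝ) :
    ∑ j ∈ J, share J σ j t * cappedSpeed δ J σ t = cappedSpeed δ J σ t := by
  rw [← Finset.sum_mul]
  rcases eq_or_ne (totalSpeed J σ t) 0 with h | h
  · have : cappedSpeed δ J σ t = 0 := le_antisymm ((cappedSpeed_le t).trans h.le) zero_le
    rw [this, mul_zero]
  · simp only [share]
    rw [← Finset.sum_div, ← totalSpeed, div_self h, one_mul]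

theorem Job.lag_pos (hδ0 : 0 < δ) (j : Job) : 0 < δ * (j.deadline - j.release) :=
  mul_pos hδ0 j.duration_pos

theorem FeasibleEarly.lintegral_deferred_le (h : FeasibleEarly δ J σ) {j : Job} (hj : j ∈ J) :
    ∫⁻ t, (deferred δ J σ j t : ℝ≥0∞) ≤ j.work := by
  rw [← (h j hj).2.2]
  refine lintegral_mono fun t => ENNReal.coe_le_coe.2 ?_
  rw [← share_mul_cappedSpeed_add_deferred (δ := δ) (σ := σ) hj t]
  exact le_add_self

theorem FeasibleEarly.window_deferred_ne_top (h : FeasibleEarly δ J σ) {j : Job} (hj : j ∈ J)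
    (L t : ℝ) : window L (fun u => (deferred δ J σ j u : ℝ≥0∞)) t ≠ ⊤ :=
  ne_top_of_le_ne_top ENNReal.coe_ne_top ((window_le _ _ t).trans (h.lintegral_deferred_le hj))

theorem FeasibleEarly.coe_robustify (h : FeasibleEarly δ J σ) (hδ0 : 0 < δ) {j : Job}
    (hj : j ∈ J) (t : ℝ) : (robustify δ J σ j t : ℝ≥0∞) =
      share J σ j t * cappedSpeed δ J σ t +
        window (δ * (j.deadline - j.release)) (fun u => (deferred δ J σ j u : ℝ≥0∞)) t /
          ENNReal.ofReal (δ * (j.deadline - j.release)) := by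
  rw [robustify, ENNReal.coe_add, ENNReal.coe_mul,
    ENNReal.coe_div (Real.toNNReal_pos.2 (j.lag_pos hδ0)).ne',
    ENNReal.coe_toNNReal (h.window_deferred_ne_top hj _ t)]
  rfl

theorem FeasibleEarly.robustify_eq_zero (h : FeasibleEarly δ J σ) (hδ0 : 0 < δ) {j : Job}
    (hj : j ∈ J) {t : ℝ} (ht : t ∉ Icc j.release j.deadline) : robustify δ J σ j t = 0 := by
  have hd := j.lag_pos hδ0
  have hσ : ∀ u, u ∉ Icc j.release (j.release + (1 - δ) * (j.deadline - j.release)) →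
      share J σ j u = 0 := fun u hu => by rw [share, (h j hj).2.1 u hu, zero_div]
  have h1 : share J σ j t = 0 := hσ t fun hu => ht ⟨hu.1, by linarith [hu.2]⟩
  have h2 : window (δ * (j.deadline - j.release)) (fun u => (deferred δ J σ j u : ℝ≥0∞)) t = 0 := by
    refine window_eq_zero (r := j.release)
      (e := j.release + (1 - δ) * (j.deadline - j.release)) (fun u hu => ?_) fun hu => ht ?_
    · rw [deferred, hσ u hu, zero_mul, ENNReal.coe_zero]
    · exact ⟨hu.1, by linarith [hu.2]⟩
  rw [robustify, h1, h2]
  simp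

/-- The executed and the deferred part add up to `σ j`, and spreading conserves the deferred work.
It delays work by at most `δ` times the duration, the slack left by the early deadline. -/
theorem FeasibleEarly.feasible_robustify (h : FeasibleEarly δ J σ) (hδ0 : 0 < δ) :
    Feasible J (robustify δ J σ) := by
  intro j hj
  have hd := j.lag_pos hδ0
  have hdm := (h.measurable_deferred hj).coe_nnreal_ennreal
  refine ⟨?_, fun t ht => h.robustify_eq_zero hδ0 hj ht, ?_⟩
  · exact ((h.measurable_share hj).mul h.measurable_cappedSpeed).add
      ((measurable_window _ hdm).ennreal_toNNReal.div_const _)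
  · rw [setLIntegral_eq_of_support_subset (by
      intro t ht
      by_contra hnot
      exact ht (by simp [h.robustify_eq_zero hδ0 hj hnot]))]
    simp only [h.coe_robustify hδ0 hj]
    have hsc : Measurable fun t => (share J σ j t : ℝ≥0∞) * cappedSpeed δ J σ t :=
      (h.measurable_share hj).coe_nnreal_ennreal.mul h.measurable_cappedSpeed.coe_nnreal_ennreal
    rw [lintegral_add_left hsc]
    simp only [div_eq_mul_inv]
    rw [lintegral_mul_const _ (measurable_window _ hdm), lintegral_window _ hdm,
      mul_comm (ENNReal.ofReal _), mul_assoc, ENNReal.mul_inv_cancel (by simpa using hd)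
        ENNReal.ofReal_ne_top, mul_one, ← (h j hj).2.2,
      ← lintegral_add_right _ hdm]
    refine lintegral_congr fun t => ?_
    rw [← share_mul_cappedSpeed_add_deferred (δ := δ) (σ := σ) hj t]
    push_cast
    rfl

theorem Job.work_div_lag (hδ0 : 0 < δ) (j : Job) :
    (j.work : ℝ≥0∞) / ENNReal.ofReal (δ * (j.deadline - j.release)) =
      j.density / ENNReal.ofReal δ := by
  have h1 : ENNReal.ofReal (j.deadline - j.release) ≠ 0 := by simp [j.release_lt_deadline]
  have h2 : ENNReal.ofReal δ ≠ 0 := by simpa using hδ0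
  rw [← j.density_mul, ENNReal.ofReal_mul hδ0.le,
    ENNReal.mul_div_mul_right _ _ h1 ENNReal.ofReal_ne_top]

/-! ### Cost of the robust schedule -/

/-- The robust schedule is never faster than the average rate by more than the factor `1 / δ²`. -/
theorem FeasibleEarly.sum_robustify_le (h : FeasibleEarly δ J σ) (hδ0 : 0 < δ) (hδ1 : δ < 1)
    (t : ℝ) : ((∑ j ∈ J, robustify δ J σ j t : ℝ≥0) : ℝ≥0∞) ≤
      ENNReal.ofReal (1 / δ ^ 2) * averageRate J t := by
  have hj : ∀ j ∈ J, (robustify δ J σ j t : ℝ≥0∞) ≤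
      ((share J σ j t * cappedSpeed δ J σ t : ℝ≥0) : ℝ≥0∞) +
        ENNReal.ofReal (1 / δ) *
          ((Icc j.release j.deadline).indicator (fun _ => j.density) t : ℝ≥0) := by
    intro j hj
    by_cases ht : t ∈ Icc j.release j.deadline
    · rw [h.coe_robustify hδ0 hj, indicator_of_mem ht, ENNReal.coe_mul]
      gcongr 1
      calc _ ≤ (j.work : ℝ≥0∞) / ENNReal.ofReal (δ * (j.deadline - j.release)) := by
            gcongr
            exact (window_le _ _ t).trans (h.lintegral_deferred_le hj)
        _ = _ := by
            rw [j.work_div_lag hδ0, one_div, ENNReal.ofReal_inv_of_pos hδ0, mul_comm,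
              div_eq_mul_inv]
    · rw [h.robustify_eq_zero hδ0 hj ht, ENNReal.coe_zero]
      exact zero_le
  rw [ENNReal.ofNNReal_finsetSum]
  refine (Finset.sum_le_sum hj).trans ?_
  rw [Finset.sum_add_distrib, ← Finset.mul_sum, ← ENNReal.ofNNReal_finsetSum,
    ← ENNReal.ofNNReal_finsetSum, sum_share_mul_cappedSpeed]
  change _ + ENNReal.ofReal (1 / δ) * (averageRate J t : ℝ≥0∞) ≤ _
  have h1 : (cappedSpeed δ J σ t : ℝ≥0∞) ≤
      ENNReal.ofReal ((1 - δ) / δ ^ 2) * averageRate J t := by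
    rw [ENNReal.ofReal, ← ENNReal.coe_mul]
    exact ENNReal.coe_le_coe.2 (min_le_right _ _)
  refine (add_le_add_left h1 _).trans (le_of_eq ?_)
  have : 0 ≤ (1 - δ) / δ ^ 2 := div_nonneg (sub_nonneg.2 hδ1.le) (sq_nonneg δ)
  -- The cap leaves room for the deferred work: `(1 - δ) / δ² + 1 / δ = 1 / δ²`.
  rw [← add_mul, ← ENNReal.ofReal_add this (by positivity)]
  congr 2
  field_simp
  ring

/-- Every layer of the deferred work is executed at a rate of at most `δ / (1 - δ)`. -/
theorem FeasibleEarly.sum_window_layer_le (h : FeasibleEarly δ J σ) (hδ0 : 0 < δ) (hδ1 : δ < 1)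
    (t : ℝ) {x : ℝ} (hx : 0 < x) :
    ∑ j ∈ J, (∫⁻ u in {u | (cappedSpeed δ J σ u : ℝ) ≤ x ∧ x < totalSpeed J σ u} ∩
        Icc (t - δ * (j.deadline - j.release)) t, (share J σ j u : ℝ≥0∞)) /
          ENNReal.ofReal (δ * (j.deadline - j.release)) ≤ ENNReal.ofReal (δ / (1 - δ)) := by
  classical
  set A : Set ℝ := {u | (cappedSpeed δ J σ u : ℝ) ≤ x ∧ x < totalSpeed J σ u} with hA
  have hAm : MeasurableSet A :=
    (measurableSet_le h.measurable_cappedSpeed.coe_nnreal_real measurable_const).inter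
      (measurableSet_lt measurable_const h.measurable_totalSpeed.coe_nnreal_real)
  set P : Job → Prop := fun j => ∃ u, u ∈ A ∧ u ∈ Icc (t - δ * (j.deadline - j.release)) t ∧
    u ∈ Icc j.release (j.release + (1 - δ) * (j.deadline - j.release)) with hP
  have hxr : ENNReal.ofReal x ≠ 0 := by simpa using hx
  -- On `A` the total speed exceeds `x`, so the share of `j` is at most `σ j u / x` and integrates
  -- to at most work / x. Jobs without a witness time contribute nothing.
  have hterm : ∀ j ∈ J, (∫⁻ u in A ∩ Icc (t - δ * (j.deadline - j.release)) t,
      (share J σ j u : ℝ≥0∞)) / ENNReal.ofReal (δ * (j.deadline - j.release)) ≤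
      (if P j then (j.density : ℝ≥0∞) else 0) / (ENNReal.ofReal x * ENNReal.ofReal δ) := by
    intro j hj
    split_ifs with hPj
    · calc _ ≤ ((j.work : ℝ≥0∞) / ENNReal.ofReal x) /
              ENNReal.ofReal (δ * (j.deadline - j.release)) := by
            gcongr
            rw [← (h j hj).2.2, div_eq_mul_inv, ← lintegral_mul_const _
              (h j hj).1.coe_nnreal_ennreal]
            refine (setLIntegral_mono' (hAm.inter measurableSet_Icc) fun u hu => ?_).trans
              (setLIntegral_le_lintegral _ _)
            have h1 : x < totalSpeed J σ u := hu.1.2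
            have h2 : totalSpeed J σ u ≠ 0 := by
              intro h0; rw [h0, NNReal.coe_zero] at h1; linarith
            rw [share, ENNReal.coe_div h2, ← div_eq_mul_inv]
            gcongr
            rw [← ENNReal.ofReal_coe_nnreal]
            exact ENNReal.ofReal_le_ofReal h1.le
        _ = _ := by
            rw [div_eq_mul_inv, div_eq_mul_inv, mul_right_comm,
              ← div_eq_mul_inv (j.work : ℝ≥0∞), j.work_div_lag hδ0, div_eq_mul_inv, div_eq_mul_inv, mul_assoc, mul_comm (_⁻¹),
              ENNReal.mul_inv (Or.inl hxr) (Or.inl ENNReal.ofReal_ne_top)]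
    · rw [ENNReal.zero_div]
      have : ∫⁻ u in A ∩ Icc (t - δ * (j.deadline - j.release)) t, (share J σ j u : ℝ≥0∞) = 0 := by
        refine setLIntegral_eq_zero (hAm.inter measurableSet_Icc) fun u hu => ?_
        rw [share, (h j hj).2.1 u fun hu' => hPj ⟨u, hu.1, hu.2, hu'⟩, zero_div]
        simp
      rw [this, ENNReal.zero_div]
  refine (Finset.sum_le_sum hterm).trans ?_
  simp only [div_eq_mul_inv]
  rw [← Finset.sum_mul, ← Finset.sum_filter]
  rcases (J.filter P).eq_empty_or_nonempty with hemp | hne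
  · rw [hemp]; simp
  have hch : ∀ j : Job, ∃ u : ℝ, P j → u ∈ A ∧ u ∈ Icc (t - δ * (j.deadline - j.release)) t ∧
      u ∈ Icc j.release (j.release + (1 - δ) * (j.deadline - j.release)) := by
    intro j
    by_cases hPj : P j
    · obtain ⟨u, hu⟩ := hPj
      exact ⟨u, fun _ => hu⟩
    · exact ⟨0, fun h => absurd h hPj⟩
  choose u hu using hch
  -- At the latest witness time `u i` all contributing jobs are alive: each is released by its own
  -- witness, and its window, which reaches from there to `t ≥ u i`, ends before its deadline. So
  -- their densities sum to at most the average rate at `u i`, where the cap is active and at most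
  -- `x`.
  obtain ⟨i, hi, hmax⟩ := Finset.exists_max_image _ u hne
  have hsum : ∑ j ∈ J.filter P, j.density ≤ averageRate J (u i) := by
    rw [averageRate, Finset.sum_filter]
    refine Finset.sum_le_sum fun j hj => ?_
    split_ifs with hPj
    · have h1 := hmax j (Finset.mem_filter.2 ⟨hj, hPj⟩)
      obtain ⟨_, h2, h3⟩ := hu j hPj
      obtain ⟨_, h4, _⟩ := hu i (Finset.mem_filter.1 hi).2
      rw [indicator_of_mem]
      exact ⟨h3.1.trans h1, by linarith [h4.2, h2.1, h3.2]⟩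
    · exact zero_le
  have hui := (hu i (Finset.mem_filter.1 hi).2).1
  have hcap : (1 - δ) / δ ^ 2 * averageRate J (u i) ≤ x := by
    have h1 : cappedSpeed δ J σ (u i) < totalSpeed J σ (u i) := by
      rw [← NNReal.coe_lt_coe]; exact hui.1.trans_lt hui.2
    have h2 : cappedSpeed δ J σ (u i) =
        ((1 - δ) / δ ^ 2).toNNReal * averageRate J (u i) := by
      refine (min_choice _ _).resolve_left fun heq => ?_
      exact h1.ne heq
    have h3 := hui.1
    rw [h2, NNReal.coe_mul, Real.coe_toNNReal _
      (div_nonneg (sub_nonneg.2 hδ1.le) (sq_nonneg δ))] at h3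
    exact h3
  have hd1 : 0 < 1 - δ := sub_pos.2 hδ1
  have hB : (averageRate J (u i) : ℝ) ≤ δ / (1 - δ) * (x * δ) := by
    rw [div_mul_eq_mul_div, le_div_iff₀ hd1]
    rw [div_mul_eq_mul_div, div_le_iff₀ (by positivity)] at hcap
    linarith
  rw [← div_eq_mul_inv]
  refine ENNReal.div_le_of_le_mul ?_
  rw [← ENNReal.ofNNReal_finsetSum, ← ENNReal.ofReal_mul hx.le, ← ENNReal.ofReal_mul (by positivity)]
  refine (ENNReal.coe_le_coe.2 hsum).trans ?_
  rw [← ENNReal.ofReal_coe_nnreal]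
  exact ENNReal.ofReal_le_ofReal hB

/-- The level estimate at time `t`: the base is the capped speed, and each recent time `u` supplies
the layer from capped to total speed, weighted by share over lag. The multiplicity bound is `1 + δ /
(1 - δ) = 1 / (1 - δ)`. -/
theorem FeasibleEarly.sum_robustify_rpow_le (h : FeasibleEarly δ J σ) (hδ0 : 0 < δ) (hδ1 : δ < 1)
    {α : ℝ} (hα : 1 ≤ α) (t : ℝ) :
    ((∑ j ∈ J, robustify δ J σ j t : ℝ≥0) : ℝ≥0∞) ^ α ≤ ENNReal.ofReal (1 / (1 - δ)) ^ (α - 1) *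
      ((cappedSpeed δ J σ t : ℝ≥0∞) ^ α + ∑ j ∈ J, window (δ * (j.deadline - j.release))
        (fun u => share J σ j u * ((totalSpeed J σ u : ℝ≥0∞) ^ α - (cappedSpeed δ J σ u : ℝ≥0∞) ^ α))
          t / ENNReal.ofReal (δ * (j.deadline - j.release))) := by
  have hd1 : 0 < 1 - δ := sub_pos.2 hδ1
  set ν : Job → Measure ℝ := fun j => (ENNReal.ofReal (δ * (j.deadline - j.release)))⁻¹ •
    ((volume.restrict (Icc (t - δ * (j.deadline - j.release)) t)).withDensity
      fun u => (share J σ j u : ℝ≥0∞)) with hν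
  have hνint : ∀ f : ℝ → ℝ≥0∞, Measurable f → ∫⁻ u, f u ∂(∑ j ∈ J, ν j) =
      ∑ j ∈ J, window (δ * (j.deadline - j.release)) (fun u => share J σ j u * f u) t /
        ENNReal.ofReal (δ * (j.deadline - j.release)) := by
    intro f hf
    rw [lintegral_finsetSum_measure]
    refine Finset.sum_congr rfl fun j hj => ?_
    rw [hν, lintegral_smul_measure, lintegral_withDensity_eq_lintegral_mul _
      (h.measurable_share hj).coe_nnreal_ennreal hf, smul_eq_mul, mul_comm, ← div_eq_mul_inv]
    rfl
  have hTm := h.measurable_totalSpeed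
  have hCm := h.measurable_cappedSpeed
  have hdef : ∫⁻ u, ((totalSpeed J σ u : ℝ≥0∞) - cappedSpeed δ J σ u) ∂(∑ j ∈ J, ν j) =
      ∑ j ∈ J, window (δ * (j.deadline - j.release)) (fun u => (deferred δ J σ j u : ℝ≥0∞)) t /
        ENNReal.ofReal (δ * (j.deadline - j.release)) := by
    rw [hνint _ (by fun_prop)]
    simp only [deferred, ENNReal.coe_mul, ENNReal.coe_sub]
  have hsum : ((∑ j ∈ J, robustify δ J σ j t : ℝ≥0) : ℝ≥0∞) = cappedSpeed δ J σ t +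
      ∫⁻ u, ((totalSpeed J σ u : ℝ≥0∞) - cappedSpeed δ J σ u) ∂(∑ j ∈ J, ν j) := by
    rw [hdef, ENNReal.ofNNReal_finsetSum, Finset.sum_congr rfl fun j hj => h.coe_robustify hδ0 hj t,
      Finset.sum_add_distrib]
    congr 1
    nth_rewrite 2 [← sum_share_mul_cappedSpeed (δ := δ) (J := J) (σ := σ) t]
    push_cast
    rfl
  have hM : ∀ x : ℝ, 0 < x → 1 + (∑ j ∈ J, ν j)
      {u | (cappedSpeed δ J σ u : ℝ) ≤ x ∧ x < totalSpeed J σ u} ≤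
        ((1 / (1 - δ)).toNNReal : ℝ≥0∞) := by
    intro x hx
    have hAm : MeasurableSet {u | (cappedSpeed δ J σ u : ℝ) ≤ x ∧ x < totalSpeed J σ u} :=
      (measurableSet_le hCm.coe_nnreal_real measurable_const).inter
        (measurableSet_lt measurable_const hTm.coe_nnreal_real)
    have h1 := h.sum_window_layer_le hδ0 hδ1 t hx
    rw [Measure.finsetSum_apply]
    have h2 : ∀ j ∈ J, ν j {u | (cappedSpeed δ J σ u : ℝ) ≤ x ∧ x < totalSpeed J σ u} =
        (∫⁻ u in {u | (cappedSpeed δ J σ u : ℝ) ≤ x ∧ x < totalSpeed J σ u} ∩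
          Icc (t - δ * (j.deadline - j.release)) t, (share J σ j u : ℝ≥0∞)) /
            ENNReal.ofReal (δ * (j.deadline - j.release)) := by
      intro j _
      rw [hν, Measure.smul_apply, withDensity_apply _ hAm, Measure.restrict_restrict hAm,
        smul_eq_mul, mul_comm, ← div_eq_mul_inv]
    rw [Finset.sum_congr rfl h2]
    refine (add_le_add_right h1 1).trans (le_of_eq ?_)
    rw [← ENNReal.ofReal_one, ← ENNReal.ofReal_add zero_le_one (by positivity)]
    change _ = ENNReal.ofReal (1 / (1 - δ))
    congr 1
    field_simp
    ring
  rw [hsum, ← hνint _ (by fun_prop)]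
  have : SFinite (∑ j ∈ J, ν j) := Finset.sum_induction _ (fun μ : Measure ℝ => SFinite μ)
    (fun _ _ _ _ => inferInstance) inferInstance fun j _ => by rw [hν]; infer_instance
  refine rpow_add_lintegral_le _ hCm hTm cappedSpeed_le hα _ hM ?_
  rw [hdef]
  refine (ENNReal.sum_lt_top.2 fun j hj => ENNReal.div_lt_top
    (h.window_deferred_ne_top hj _ t) ?_).ne
  simpa using j.lag_pos hδ0

/-- Integrating over `t` removes the windows. As the shares at each time sum to at most 1, the
deferred layers then cost at most what the cap saved. -/
theorem FeasibleEarly.lintegral_sum_robustify_rpow_le (h : FeasibleEarly δ J σ) (hδ0 : 0 < δ)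
    (hδ1 : δ < 1) {α : ℝ} (hα : 1 ≤ α) :
    ∫⁻ t, ((∑ j ∈ J, robustify δ J σ j t : ℝ≥0) : ℝ≥0∞) ^ α ≤
      ENNReal.ofReal (1 / (1 - δ)) ^ (α - 1) * ∫⁻ t, (totalSpeed J σ t : ℝ≥0∞) ^ α := by
  have hTm := h.measurable_totalSpeed
  have hCm := h.measurable_cappedSpeed
  have hfm : ∀ j ∈ J, Measurable fun u => (share J σ j u : ℝ≥0∞) *
      ((totalSpeed J σ u : ℝ≥0∞) ^ α - (cappedSpeed δ J σ u : ℝ≥0∞) ^ α) := by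
    intro j hj
    have := h.measurable_share hj
    fun_prop
  have hwin : ∀ j ∈ J, Measurable fun t => window (δ * (j.deadline - j.release))
      (fun u => share J σ j u * ((totalSpeed J σ u : ℝ≥0∞) ^ α - (cappedSpeed δ J σ u : ℝ≥0∞) ^ α))
        t / ENNReal.ofReal (δ * (j.deadline - j.release)) :=
    fun j hj => (measurable_window _ (hfm j hj)).div_const _
  refine (lintegral_mono fun t => h.sum_robustify_rpow_le hδ0 hδ1 hα t).trans ?_
  have hwins := Finset.measurable_fun_sum J hwin
  rw [lintegral_const_mul _ (by fun_prop), lintegral_add_left (hCm.coe_nnreal_ennreal.pow_const α),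
    lintegral_finsetSum _ hwin]
  gcongr 1
  have h1 : ∀ j ∈ J, ∫⁻ t, window (δ * (j.deadline - j.release))
      (fun u => share J σ j u * ((totalSpeed J σ u : ℝ≥0∞) ^ α - (cappedSpeed δ J σ u : ℝ≥0∞) ^ α))
        t / ENNReal.ofReal (δ * (j.deadline - j.release)) =
      ∫⁻ u, share J σ j u * ((totalSpeed J σ u : ℝ≥0∞) ^ α - (cappedSpeed δ J σ u : ℝ≥0∞) ^ α) := by
    intro j hj
    simp only [div_eq_mul_inv]
    rw [lintegral_mul_const _ (measurable_window _ (hfm j hj)), lintegral_window _ (hfm j hj),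
      mul_comm (ENNReal.ofReal _), mul_assoc, ENNReal.mul_inv_cancel
        (by simpa using j.lag_pos hδ0) ENNReal.ofReal_ne_top, mul_one]
  rw [Finset.sum_congr rfl h1, ← lintegral_finsetSum _ hfm,
    ← lintegral_add_left (hCm.coe_nnreal_ennreal.pow_const α)]
  refine lintegral_mono fun t => ?_
  have h2 : (cappedSpeed δ J σ t : ℝ≥0∞) ^ α ≤ (totalSpeed J σ t : ℝ≥0∞) ^ α :=
    ENNReal.rpow_le_rpow (ENNReal.coe_le_coe.2 (cappedSpeed_le t)) (zero_le_one.trans hα)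
  calc _ ≤ (cappedSpeed δ J σ t : ℝ≥0∞) ^ α +
        1 * ((totalSpeed J σ t : ℝ≥0∞) ^ α - (cappedSpeed δ J σ t : ℝ≥0∞) ^ α) := by
        rw [← Finset.sum_mul, ← ENNReal.ofNNReal_finsetSum]
        gcongr
        exact_mod_cast sum_share_le_one t
    _ = _ := by rw [one_mul, add_tsub_cancel_of_le h2]

theorem FeasibleEarly.lintegral_sum_robustify_rpow_le_averageRate (h : FeasibleEarly δ J σ)
    (hδ0 : 0 < δ) (hδ1 : δ < 1) {α : ℝ} (hα : 0 ≤ α) :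
    ∫⁻ t, ((∑ j ∈ J, robustify δ J σ j t : ℝ≥0) : ℝ≥0∞) ^ α ≤
      ENNReal.ofReal (1 / δ ^ 2) ^ α * ∫⁻ t, (averageRate J t : ℝ≥0∞) ^ α := by
  rw [← lintegral_const_mul _ ((measurable_averageRate J).coe_nnreal_ennreal.pow_const α)]
  refine lintegral_mono fun t => ?_
  rw [← ENNReal.mul_rpow_of_nonneg _ _ hα]
  exact ENNReal.rpow_le_rpow (h.sum_robustify_le hδ0 hδ1 t) hα

end

/-! ### Online dependence -/

section Online

variable {δ : ℝ} {J J' : JobSet} {σ σ' : Schedule} {t : ℝ}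

theorem SameJobsUpTo.filter_eq (h : SameJobsUpTo t J J') {u : ℝ} (hu : u ≤ t) :
    J.filter (fun j => j.release ≤ u) = J'.filter (fun j => j.release ≤ u) := by
  ext j
  simp only [Finset.mem_filter]
  exact and_congr_left fun hj => h j (hj.trans hu)

theorem FeasibleEarly.totalSpeed_eq (h : FeasibleEarly δ J σ) (u : ℝ) :
    totalSpeed J σ u = ∑ j ∈ J.filter (fun j => j.release ≤ u), σ j u := by
  rw [totalSpeed, Finset.sum_filter_of_ne]
  intro j hj hne
  by_contra hlt
  exact hne ((h j hj).2.1 u fun hu => hlt hu.1)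

theorem averageRate_eq (J : JobSet) (u : ℝ) : averageRate J u =
    ∑ j ∈ J.filter (fun j => j.release ≤ u),
      (Icc j.release j.deadline).indicator (fun _ => j.density) u := by
  rw [averageRate, Finset.sum_filter_of_ne]
  intro j _ hne
  by_contra hlt
  exact hne (indicator_of_notMem (fun hu => hlt hu.1) _)

/-- Unreleased jobs have neither speed nor density, so total speed and cap at time `u` see only the
jobs released by `u`; the windows look backwards. -/
theorem FeasibleEarly.sameScheduleUpTo_robustify (h : FeasibleEarly δ J σ)
    (h' : FeasibleEarly δ J' σ') (hJ : SameJobsUpTo t J J')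
    (hσ : ∀ j ∈ J, j.release ≤ t → ∀ u ≤ t, σ j u = σ' j u) :
    SameScheduleUpTo t J (robustify δ J σ) (robustify δ J' σ') := by
  have hT : ∀ u ≤ t, totalSpeed J σ u = totalSpeed J' σ' u := fun u hu => by
    rw [h.totalSpeed_eq, h'.totalSpeed_eq, ← hJ.filter_eq hu]
    refine Finset.sum_congr rfl fun j hj => ?_
    obtain ⟨hj, hr⟩ := Finset.mem_filter.1 hj
    exact hσ j hj (hr.trans hu) u hu
  have hC : ∀ u ≤ t, cappedSpeed δ J σ u = cappedSpeed δ J' σ' u := fun u hu => by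
    rw [cappedSpeed, cappedSpeed, hT u hu, averageRate_eq J, averageRate_eq J', ← hJ.filter_eq hu]
  intro j hj hr τ hτ
  have hS : ∀ u ≤ t, share J σ j u = share J' σ' j u := fun u hu => by
    rw [share, share, hT u hu, hσ j hj hr u hu]
  have hD : window (δ * (j.deadline - j.release)) (fun u => (deferred δ J σ j u : ℝ≥0∞)) τ =
      window (δ * (j.deadline - j.release)) (fun u => (deferred δ J' σ' j u : ℝ≥0∞)) τ :=
    setLIntegral_congr_fun measurableSet_Icc fun u hu => by
      have hut := hu.2.trans hτ
      simp only [deferred, hS u hut, hT u hut, hC u hut]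
  rw [robustify, robustify, hS τ hτ, hC τ hτ, hD]

end Online

/-! ### The conversion for shrunk instances -/

section Conversion

variable (δ : ℝ) (hδ : δ < 1)

/-- Guarantees that no two jobs merge in the image that defines the shrunk instance, so sums over it
can be reindexed. -/
theorem Job.shrink_injective : Function.Injective (Job.shrink δ hδ) := by
  intro i j h
  have h1 := congrArg Job.index h
  have h2 := congrArg Job.release h
  have h3 := congrArg Job.deadline h
  have h4 := congrArg Job.work h
  simp only [Job.shrink] at h1 h2 h3 h4
  rw [h2] at h3
  have h5 := mul_left_cancel₀ (sub_pos.2 hδ).ne' (add_left_cancel h3)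
  exact Job.ext h1 h2 (by linarith) h4

theorem shrink_mem_shrink {J : JobSet} {j : Job} (hj : j ∈ J) : j.shrink δ hδ ∈ shrink δ hδ J := by
  classical
  exact Finset.mem_image_of_mem _ hj

theorem sum_shrink {M : Type*} [AddCommMonoid M] (J : JobSet) (f : Job → M) :
    ∑ j ∈ shrink δ hδ J, f j = ∑ j ∈ J, f (j.shrink δ hδ) := by
  classical
  exact Finset.sum_image fun _ _ _ _ h => Job.shrink_injective δ hδ h

/-- The online conversion of schedules of the shrunk instance into robust schedules. -/
noncomputable def conversion (J : JobSet) (s : Schedule) : Schedule :=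
  robustify δ J fun j => s (j.shrink δ hδ)

theorem Feasible.lintegral_eq {J : JobSet} {s : Schedule} (h : Feasible J s) {j : Job}
    (hj : j ∈ J) : ∫⁻ t, (s j t : ℝ≥0∞) = j.work := by
  rw [← (h j hj).2.2, setLIntegral_eq_of_support_subset]
  intro t ht
  by_contra hnot
  exact ht (by simp [(h j hj).2.1 t hnot])

theorem Feasible.feasibleEarly {J : JobSet} {s : Schedule} (h : Feasible (shrink δ hδ J) s) :
    FeasibleEarly δ J fun j => s (j.shrink δ hδ) := fun _ hj =>
  have hj' := shrink_mem_shrink δ hδ hj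
  ⟨(h _ hj').1, (h _ hj').2.1, h.lintegral_eq hj'⟩

theorem cost_shrink (α : ℝ) (J : JobSet) (s : Schedule) : cost α (shrink δ hδ J) s =
    ∫⁻ t, (totalSpeed J (fun j => s (j.shrink δ hδ)) t : ℝ≥0∞) ^ α := by
  simp only [cost, sum_shrink, totalSpeed]

theorem isOnlineConversion_conversion (hδ0 : 0 < δ) :
    IsOnlineConversion δ hδ (conversion δ hδ) := by
  refine ⟨fun J s h => (h.feasibleEarly δ hδ).feasible_robustify hδ0,
    fun t J J' s s' h h' hJ hs => ?_⟩
  exact (h.feasibleEarly δ hδ).sameScheduleUpTo_robustify (h'.feasibleEarly δ hδ) hJ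
    fun j hj hr u hu => hs _ (shrink_mem_shrink δ hδ hj) hr u hu

theorem cost_conversion_le (hδ0 : 0 < δ) {α : ℝ} (hα : 1 < α) {J : JobSet} {s : Schedule}
    (h : Feasible (shrink δ hδ J) s) : cost α J (conversion δ hδ J s) ≤
      ENNReal.ofReal ((1 / (1 - δ)) ^ (α - 1)) * cost α (shrink δ hδ J) s := by
  have hd1 : 0 < 1 - δ := sub_pos.2 hδ
  rw [cost_shrink, ← ENNReal.ofReal_rpow_of_pos (by positivity)]
  exact (h.feasibleEarly δ hδ).lintegral_sum_robustify_rpow_le hδ0 hδ hα.le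

theorem cost_conversion_le_opt (hδ0 : 0 < δ) {α : ℝ} (hα : 1 < α) {J : JobSet} {s : Schedule}
    (h : Feasible (shrink δ hδ J) s) : cost α J (conversion δ hδ J s) ≤
      ENNReal.ofReal ((2 * α / δ ^ 2) ^ α / 2) * OPT α J := by
  have hα0 : 0 < α := zero_lt_one.trans hα
  have hne : ENNReal.ofReal ((2 * α / δ ^ 2) ^ α / 2) ≠ 0 := by
    rw [Ne, ENNReal.ofReal_eq_zero, not_le]
    positivity
  rw [OPT, ENNReal.mul_iInf_of_ne hne ENNReal.ofReal_ne_top]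
  refine le_iInf fun s' => ?_
  rw [ENNReal.mul_iInf_of_ne hne ENNReal.ofReal_ne_top]
  refine le_iInf fun hs' => ?_
  refine ((h.feasibleEarly δ hδ).lintegral_sum_robustify_rpow_le_averageRate hδ0 hδ
    hα0.le).trans ?_
  refine (mul_le_mul_right (lintegral_averageRate_rpow_le hα hs') _).trans (le_of_eq ?_)
  rw [← mul_assoc, ENNReal.ofReal_rpow_of_pos (by positivity), ← ENNReal.ofReal_mul (by positivity),
    ← mul_div_assoc, ← Real.mul_rpow (by positivity) (by positivity)]
  congr 4
  ring

theorem sameJobsUpTo_shrink {t : ℝ} {J J' : JobSet} (h : SameJobsUpTo t J J') :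
    SameJobsUpTo t (shrink δ hδ J) (shrink δ hδ J') := by
  classical
  intro i hi
  simp only [shrink, Finset.mem_image]
  constructor <;> rintro ⟨j, hj, rfl⟩
  · exact ⟨j, (h j hi).1 hj, rfl⟩
  · exact ⟨j, (h j hi).2 hj, rfl⟩

theorem IsOnlineConversion.isOnlineAlgorithm {R : JobSet → Schedule → Schedule}
    (hR : IsOnlineConversion δ hδ R) {A : JobSet → Schedule} (hA : IsOnlineAlgorithm A) :
    IsOnlineAlgorithm fun J => R J (A (shrink δ hδ J)) :=
  ⟨fun _ => hR.1 _ _ (hA.1 _), fun t _ _ hJ => hR.2 t _ _ _ _ (hA.1 _) (hA.1 _) hJ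
    (hA.2 t _ _ (sameJobsUpTo_shrink δ hδ hJ))⟩

end Conversion

/-! ### A cell-wise schedule with supporting prices -/

section Cells

open Classical in
/-- The jobs of `J` that are alive at time `t`. -/
noncomputable def aliveJobs (J : JobSet) (t : ℝ) : Finset Job :=
  J.filter fun j => t ∈ Icc j.release j.deadline

/-- The times at which exactly the jobs of `A` are alive. -/
def cell (J : JobSet) (A : Finset Job) : Set ℝ := {t | aliveJobs J t = A}

variable {J : JobSet}

theorem mem_aliveJobs {j : Job} {t : ℝ} :
    j ∈ aliveJobs J t ↔ j ∈ J ∧ t ∈ Icc j.release j.deadline := Finset.mem_filter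

theorem aliveJobs_mem_powerset (J : JobSet) (t : ℝ) : aliveJobs J t ∈ J.powerset :=
  Finset.mem_powerset.2 (Finset.filter_subset _ _)

theorem measurableSet_cell (J : JobSet) (A : Finset Job) : MeasurableSet (cell J A) := by
  classical
  by_cases hA : A ⊆ J
  · have : cell J A = ⋂ j ∈ J, {t | t ∈ Icc j.release j.deadline ↔ j ∈ A} := by
      ext t
      simp only [cell, mem_ofPred_eq, mem_iInter, Finset.ext_iff, mem_aliveJobs]
      constructor
      · intro h j hj
        rw [← h j]
        exact ⟨fun ht => ⟨hj, ht⟩, fun ht => ht.2⟩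
      · intro h j
        exact ⟨fun ht => (h j ht.1).1 ht.2, fun hj => ⟨hA hj, (h j (hA hj)).2 hj⟩⟩
    rw [this]
    refine Finset.measurableSet_biInter J fun j _ => ?_
    by_cases hj : j ∈ A
    · simp only [hj, iff_true]; exact measurableSet_Icc
    · simp only [hj, iff_false]; exact measurableSet_Icc.compl
  · convert MeasurableSet.empty
    rw [eq_empty_iff_forall_notMem]
    rintro t rfl
    exact hA (Finset.filter_subset _ _)

theorem apply_aliveJobs {M : Type*} [AddCommMonoid M] (f : Finset Job → M) (t : ℝ) :
    f (aliveJobs J t) = ∑ A ∈ J.powerset, (cell J A).indicator (fun _ => f A) t := by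
  rw [Finset.sum_eq_single (aliveJobs J t)]
  · exact (indicator_of_mem (s := cell J (aliveJobs J t)) rfl (fun _ => f (aliveJobs J t))).symm
  · intro A _ hA
    exact indicator_of_notMem (fun ht => hA (Eq.symm ht)) _
  · exact fun h => absurd (aliveJobs_mem_powerset J t) h

theorem measurable_apply_aliveJobs (f : Finset Job → ℝ≥0) :
    Measurable fun t => f (aliveJobs J t) := by
  simp only [apply_aliveJobs f]
  exact Finset.measurable_fun_sum _ fun A _ => measurable_const.indicator (measurableSet_cell J A)

theorem lintegral_apply_aliveJobs (f : Finset Job → ℝ≥0∞) :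
    ∫⁻ t, f (aliveJobs J t) = ∑ A ∈ J.powerset, f A * volume (cell J A) := by
  simp only [apply_aliveJobs f]
  rw [lintegral_finsetSum _ fun A _ => measurable_const.indicator (measurableSet_cell J A)]
  refine Finset.sum_congr rfl fun A _ => ?_
  rw [lintegral_indicator (measurableSet_cell J A), lintegral_const, Measure.restrict_apply_univ]

/-- The length of a cell. -/
noncomputable def cellLength (J : JobSet) (A : Finset Job) : ℝ := volume.real (cell J A)

theorem cellLength_nonneg (A : Finset Job) : 0 ≤ cellLength J A := measureReal_nonneg

/-- A member of `A` confines the cell to a bounded interval. The cell of `∅` has infinite volume,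
while its `cellLength` is 0 by convention. -/
theorem volume_cell {A : Finset Job} {j : Job} (hj : j ∈ A) :
    volume (cell J A) = ENNReal.ofReal (cellLength J A) := by
  rw [cellLength, Measure.real, ENNReal.ofReal_toReal]
  refine ne_top_of_le_ne_top (b := volume (Icc j.release j.deadline)) (by simp)
    (measure_mono fun t ht => ?_)
  have ht : aliveJobs J t = A := ht
  rw [← ht] at hj
  exact (mem_aliveJobs.1 hj).2

open Classical in
/-- The cells of positive length in which `j` is alive. -/
noncomputable def cellsOf (J : JobSet) (j : Job) : Finset (Finset Job) :=
  J.powerset.filter fun A => j ∈ A ∧ 0 < cellLength J A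

theorem mem_cellsOf {j : Job} {A : Finset Job} :
    A ∈ cellsOf J j ↔ A ∈ J.powerset ∧ j ∈ A ∧ 0 < cellLength J A := by
  classical
  exact Finset.mem_filter

/-- Otherwise the lifetime of `j` would be a finite union of null cells. -/
theorem cellsOf_nonempty {j : Job} (hj : j ∈ J) : (cellsOf J j).Nonempty := by
  classical
  by_contra hemp
  rw [Finset.not_nonempty_iff_eq_empty] at hemp
  have h1 : ∫⁻ t, (if j ∈ aliveJobs J t then (1 : ℝ≥0∞) else 0) = 0 := by
    rw [lintegral_apply_aliveJobs fun A => if j ∈ A then (1 : ℝ≥0∞) else 0]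
    refine Finset.sum_eq_zero fun A hA => ?_
    split_ifs with hjA
    · have : A ∉ cellsOf J j := by rw [hemp]; simp
      rw [mem_cellsOf, not_and, not_and, not_lt] at this
      rw [volume_cell hjA, ENNReal.ofReal_eq_zero.2 (this hA hjA), mul_zero]
    · rw [zero_mul]
  have h2 : ∫⁻ t, (if j ∈ aliveJobs J t then (1 : ℝ≥0∞) else 0) =
      volume (Icc j.release j.deadline) := by
    rw [← lintegral_indicator_one measurableSet_Icc]
    refine lintegral_congr fun t => ?_
    by_cases ht : t ∈ Icc j.release j.deadline
    · rw [indicator_of_mem ht, if_pos (mem_aliveJobs.2 ⟨hj, ht⟩), Pi.one_apply]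
    · rw [indicator_of_notMem ht, if_neg fun h => ht (mem_aliveJobs.1 h).2]
  rw [h2, Real.volume_Icc, ENNReal.ofReal_eq_zero] at h1
  linarith [j.duration_pos]

/-- The work of `J` is distributed to the cells: `v (j, A)` is the work of `j` in the cell `A`. -/
def allocations (J : JobSet) : Set (Job × Finset Job → ℝ) :=
  {v | (∀ p, 0 ≤ v p) ∧ (∀ p, p.2 ∉ cellsOf J p.1 → v p = 0) ∧
    ∀ j ∈ J, ∑ A ∈ J.powerset, v (j, A) = j.work}

/-- The speed in a cell. -/
noncomputable def cellSpeed (J : JobSet) (v : Job × Finset Job → ℝ) (A : Finset Job) : ℝ :=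
  (∑ j ∈ J, v (j, A)) / cellLength J A

/-- The cost of an allocation. -/
noncomputable def allocationCost (α : ℝ) (J : JobSet) (v : Job × Finset Job → ℝ) : ℝ :=
  ∑ A ∈ J.powerset, cellLength J A * cellSpeed J v A ^ α

theorem cellSpeed_nonneg {v : Job × Finset Job → ℝ} (hv : v ∈ allocations J) (A : Finset Job) :
    0 ≤ cellSpeed J v A :=
  div_nonneg (Finset.sum_nonneg fun _ _ => hv.1 _) (cellLength_nonneg A)

open Classical in
/-- The allocation that processes every job in a single cell. -/
noncomputable def singleCellAllocation (J : JobSet) (c : Job → Finset Job) :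
    Job × Finset Job → ℝ :=
  fun p => if p.1 ∈ J ∧ p.2 = c p.1 then p.1.work else 0

theorem singleCellAllocation_mem {c : Job → Finset Job} (hc : ∀ j ∈ J, c j ∈ cellsOf J j) :
    singleCellAllocation J c ∈ allocations J := by
  classical
  refine ⟨fun p => ?_, fun p hp => ?_, fun j hj => ?_⟩
  · unfold singleCellAllocation
    split_ifs
    · exact NNReal.coe_nonneg _
    · exact le_rfl
  · refine if_neg fun h => hp ?_
    rw [h.2]
    exact hc _ h.1
  · simp only [singleCellAllocation, hj, true_and]
    rw [Finset.sum_ite_eq' J.powerset (c j), if_pos (mem_cellsOf.1 (hc j hj)).1]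

theorem isCompact_allocations (J : JobSet) :
    IsCompact (allocations J ∩ {v | ∀ p, p.1 ∉ J → v p = 0}) := by
  classical
  -- The index type is infinite, so compactness comes from Tychonoff; the constraints are closed in
  -- the product topology.
  have hK : IsCompact (univ.pi fun p : Job × Finset Job => Icc (0 : ℝ) p.1.work) :=
    isCompact_univ_pi fun _ => isCompact_Icc
  refine hK.of_isClosed_subset ?_ ?_
  · simp only [allocations, ofPred_and, ofPred_forall]
    refine ((isClosed_iInter fun p => ?_).inter ((isClosed_iInter fun p => isClosed_iInter
      fun _ => ?_).inter (isClosed_iInter fun j => isClosed_iInter fun _ => ?_))).inter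
      (isClosed_iInter fun p => isClosed_iInter fun _ => ?_)
    · exact isClosed_le continuous_const (continuous_apply p)
    · exact isClosed_eq (continuous_apply p) continuous_const
    · exact isClosed_eq (continuous_finsetSum _ fun A _ => continuous_apply _) continuous_const
    · exact isClosed_eq (continuous_apply p) continuous_const
  · rintro v ⟨⟨h0, hz, hw⟩, hJ⟩ p _
    refine ⟨h0 p, ?_⟩
    by_cases hp : p.1 ∈ J
    · by_cases hA : p.2 ∈ cellsOf J p.1
      · rw [← hw p.1 hp]
        exact Finset.single_le_sum (f := fun A => v (p.1, A)) (fun _ _ => h0 _)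
          (mem_cellsOf.1 hA).1
      · rw [hz p hA]; exact NNReal.coe_nonneg _
    · rw [hJ p hp]; exact NNReal.coe_nonneg _

theorem continuous_allocationCost {α : ℝ} (hα : 0 ≤ α) (J : JobSet) :
    Continuous (allocationCost α J) := by
  unfold allocationCost cellSpeed
  refine continuous_finsetSum _ fun A _ => continuous_const.mul (Continuous.rpow_const ?_
    fun _ => Or.inr hα)
  exact (continuous_finsetSum _ fun j _ => continuous_apply (j, A)).div_const _

theorem nonneg_of_hasDerivAt_of_le {f : ℝ → ℝ} {f' : ℝ} (hf : HasDerivAt f f' 0)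
    (hmin : ∀ θ ∈ Ioc (0 : ℝ) 1, f 0 ≤ f θ) : 0 ≤ f' := by
  have h := (hasDerivAt_iff_tendsto_slope.1 hf).mono_left
    (nhdsWithin_mono 0 fun x (hx : x ∈ Ioi 0) => (mem_Ioi.1 hx).ne')
  refine ge_of_tendsto h ?_
  filter_upwards [Ioc_mem_nhdsGT (zero_lt_one' ℝ)] with θ hθ
  rw [slope_def_field, sub_zero]
  exact div_nonneg (sub_nonneg.2 (hmin θ hθ)) hθ.1.le

/-- The first order condition for the optimality of an allocation. -/
theorem sum_cellSpeed_rpow_le {α : ℝ} (hα : 1 < α) {v v' : Job × Finset Job → ℝ}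
    (hmin : ∀ θ ∈ Ioc (0 : ℝ) 1, allocationCost α J v ≤ allocationCost α J (v + θ • (v' - v))) :
    allocationCost α J v ≤ ∑ j ∈ J, ∑ A ∈ J.powerset, v' (j, A) * cellSpeed J v A ^ (α - 1) := by
  have hα0 : 0 < α := zero_lt_one.trans hα
  set V : Finset Job → ℝ := fun A => ∑ j ∈ J, v (j, A) with hV
  set V' : Finset Job → ℝ := fun A => ∑ j ∈ J, v' (j, A) with hV'
  have hcs : ∀ θ A, cellSpeed J (v + θ • (v' - v)) A =
      (V A + θ * (V' A - V A)) / cellLength J A := by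
    intro θ A
    rw [cellSpeed, hV, hV']
    simp only [Pi.add_apply, Pi.smul_apply, Pi.sub_apply, smul_eq_mul, Finset.sum_add_distrib,
      ← Finset.mul_sum, Finset.sum_sub_distrib]
  have hder : HasDerivAt (fun θ : ℝ => allocationCost α J (v + θ • (v' - v)))
      (∑ A ∈ J.powerset, cellLength J A * ((V' A - V A) / cellLength J A * α *
        cellSpeed J v A ^ (α - 1))) 0 := by
    unfold allocationCost
    simp only [hcs]
    refine HasDerivAt.fun_sum fun A _ => HasDerivAt.const_mul _ ?_
    have h1 : HasDerivAt (fun θ : ℝ => (V A + θ * (V' A - V A)) / cellLength J A)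
        ((V' A - V A) / cellLength J A) 0 := by
      have := (((hasDerivAt_id (0 : ℝ)).mul_const (V' A - V A)).const_add (V A)).div_const
        (cellLength J A)
      simpa using this
    have h2 := h1.rpow_const (p := α) (Or.inr hα.le)
    simpa [cellSpeed, hV] using h2
  have h0 := nonneg_of_hasDerivAt_of_le hder fun θ hθ => by simpa using hmin θ hθ
  have h1 : ∀ A ∈ J.powerset, cellLength J A * ((V' A - V A) / cellLength J A * α *
        cellSpeed J v A ^ (α - 1)) ≤
      α * (V' A * cellSpeed J v A ^ (α - 1) - cellLength J A * cellSpeed J v A ^ α) := by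
    intro A hA
    -- On cells of length 0 division by zero makes the speed 0, and both sides vanish.
    rcases eq_or_ne (cellLength J A) 0 with hz | hz
    · have : cellSpeed J v A = 0 := by rw [cellSpeed, hz, div_zero]
      rw [hz, this, Real.zero_rpow (by linarith)]
      simp
    · have hs : cellLength J A * cellSpeed J v A ^ α = V A * cellSpeed J v A ^ (α - 1) := by
        rcases eq_or_ne (cellSpeed J v A) 0 with hs | hs
        · rw [hs, Real.zero_rpow hα0.ne', Real.zero_rpow (sub_pos.2 hα).ne', mul_zero, mul_zero]
        · rw [Real.rpow_sub_one hs, cellSpeed]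
          rw [cellSpeed] at hs
          have : ∑ j ∈ J, v (j, A) ≠ 0 := fun h => hs (by rw [h, zero_div])
          rw [show V A = ∑ j ∈ J, v (j, A) from rfl]
          field_simp
      rw [hs]
      refine le_of_eq ?_
      field_simp
  have h2 := h0.trans (Finset.sum_le_sum h1)
  rw [← Finset.mul_sum, Finset.sum_sub_distrib] at h2
  have h3 := nonneg_of_mul_nonneg_right h2 hα0
  rw [Finset.sum_comm]
  simp only [← Finset.sum_mul]
  exact sub_nonneg.1 h3

/-- The schedule that belongs to an allocation. -/
noncomputable def allocationSchedule (J : JobSet) (v : Job × Finset Job → ℝ) : Schedule :=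
  fun j t => (v (j, aliveJobs J t) / cellLength J (aliveJobs J t)).toNNReal

theorem feasible_allocationSchedule {v : Job × Finset Job → ℝ} (hv : v ∈ allocations J) :
    Feasible J (allocationSchedule J v) := by
  intro j hj
  have hz : ∀ t, t ∉ Icc j.release j.deadline → allocationSchedule J v j t = 0 := by
    intro t ht
    rw [allocationSchedule, hv.2.1, zero_div, Real.toNNReal_zero]
    exact fun h => ht (mem_aliveJobs.1 (mem_cellsOf.1 h).2.1).2
  refine ⟨measurable_apply_aliveJobs fun A => (v (j, A) / cellLength J A).toNNReal, hz, ?_⟩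
  rw [setLIntegral_eq_of_support_subset (by
    intro t ht
    by_contra hnot
    exact ht (by simp [hz t hnot]))]
  have h1 := lintegral_apply_aliveJobs (J := J)
    fun A => ((v (j, A) / cellLength J A).toNNReal : ℝ≥0∞)
  unfold allocationSchedule
  rw [h1]
  have h2 : ∀ A ∈ J.powerset, ((v (j, A) / cellLength J A).toNNReal : ℝ≥0∞) * volume (cell J A) =
      ENNReal.ofReal (v (j, A)) := by
    intro A _
    by_cases hA : A ∈ cellsOf J j
    · have hm := (mem_cellsOf.1 hA).2
      rw [volume_cell hm.1, ← ENNReal.ofReal, ← ENNReal.ofReal_mul (div_nonneg (hv.1 _) hm.2.le),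
        div_mul_cancel₀ _ hm.2.ne']
    · rw [hv.2.1 (j, A) hA]
      simp
  rw [Finset.sum_congr rfl h2, ← ENNReal.ofReal_sum_of_nonneg fun A _ => hv.1 _, hv.2.2 j hj,
    ENNReal.ofReal_coe_nnreal]

theorem sum_allocationSchedule {v : Job × Finset Job → ℝ} (hv : v ∈ allocations J) (t : ℝ) :
    ∑ j ∈ J, allocationSchedule J v j t = (cellSpeed J v (aliveJobs J t)).toNNReal := by
  unfold allocationSchedule cellSpeed
  rw [Finset.sum_div, Real.toNNReal_sum_of_nonneg fun j _ =>
    div_nonneg (hv.1 _) (cellLength_nonneg _)]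

theorem cost_allocationSchedule {α : ℝ} (hα : 0 < α) {v : Job × Finset Job → ℝ}
    (hv : v ∈ allocations J) :
    cost α J (allocationSchedule J v) = ENNReal.ofReal (allocationCost α J v) := by
  unfold cost
  simp only [sum_allocationSchedule hv]
  rw [lintegral_apply_aliveJobs fun A => ((cellSpeed J v A).toNNReal : ℝ≥0∞) ^ α, allocationCost,
    ENNReal.ofReal_sum_of_nonneg fun A _ => mul_nonneg (cellLength_nonneg A)
      (Real.rpow_nonneg (cellSpeed_nonneg hv A) _)]
  refine Finset.sum_congr rfl fun A _ => ?_
  rw [ENNReal.ofReal_mul (cellLength_nonneg A), mul_comm,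
    ← ENNReal.ofReal_rpow_of_nonneg (cellSpeed_nonneg hv A) hα.le]
  -- Outside all lifetimes the volume is infinite, but the speed there is 0.
  rcases A.eq_empty_or_nonempty with rfl | ⟨j, hj⟩
  · have : cellSpeed J v ∅ = 0 := by
      rw [cellSpeed, Finset.sum_eq_zero fun j _ => hv.2.1 _ fun h => by
        simpa using (mem_cellsOf.1 h).2.1, zero_div]
    rw [this]
    simp [hα]
  · rw [volume_cell hj]
    rfl

/-- An optimal schedule, together with a price for every job that does not exceed the marginal
cost of any time at which the job is alive, and such that the cost is covered by the prices. -/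
theorem exists_optimal_schedule {α : ℝ} (hα : 1 < α) (J : JobSet) :
    ∃ s : Schedule, Feasible J s ∧ ∃ y : Job → ℝ≥0,
      (∀ᵐ t, ∀ j ∈ J, t ∈ Icc j.release j.deadline → y j ≤ (∑ i ∈ J, s i t) ^ (α - 1)) ∧
      cost α J s ≤ ∑ j ∈ J, (j.work : ℝ≥0∞) * y j := by
  classical
  have hα0 : 0 < α := zero_lt_one.trans hα
  have hch : ∀ j : Job, ∃ A, j ∈ J → A ∈ cellsOf J j := fun j => by
    by_cases hj : j ∈ J
    · obtain ⟨A, hA⟩ := cellsOf_nonempty hj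
      exact ⟨A, fun _ => hA⟩
    · exact ⟨∅, fun h => absurd h hj⟩
  choose c₀ hc₀ using hch
  have hsupp : ∀ c, ∀ p : Job × Finset Job, p.1 ∉ J → singleCellAllocation J c p = 0 :=
    fun c p hp => if_neg fun h => hp h.1
  obtain ⟨v, ⟨hv, hvJ⟩, hmin⟩ := (isCompact_allocations J).exists_isMinOn
    ⟨_, singleCellAllocation_mem hc₀, hsupp c₀⟩ (continuous_allocationCost hα0.le J).continuousOn
  -- The competitor for the first order condition puts each job entirely into its slowest cell. The
  -- price of the job is the marginal cost there, up to the factor `α`.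
  have hch : ∀ j : Job, ∃ A, j ∈ J → A ∈ cellsOf J j ∧
      ∀ A' ∈ cellsOf J j, cellSpeed J v A ≤ cellSpeed J v A' := fun j => by
    by_cases hj : j ∈ J
    · obtain ⟨A, hA⟩ := Finset.exists_min_image _ (cellSpeed J v) (cellsOf_nonempty hj)
      exact ⟨A, fun _ => hA⟩
    · exact ⟨∅, fun h => absurd h hj⟩
  choose c hc using hch
  have hc' := singleCellAllocation_mem fun j hj => (hc j hj).1
  set v' := singleCellAllocation J c with hv'
  have hfirst := sum_cellSpeed_rpow_le hα (v := v) (v' := v') fun θ hθ => by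
    refine hmin ⟨⟨fun p => ?_, fun p hp => ?_, fun j hj => ?_⟩, fun p hp => ?_⟩
    · have h1 := hv.1 p
      have h2 := hc'.1 p
      simp only [Pi.add_apply, Pi.smul_apply, Pi.sub_apply, smul_eq_mul]
      nlinarith [hθ.1, hθ.2, mul_nonneg hθ.1.le h2, mul_nonneg (sub_nonneg.2 hθ.2) h1]
    · simp [hv.2.1 p hp, hc'.2.1 p hp]
    · simp only [Pi.add_apply, Pi.smul_apply, Pi.sub_apply, smul_eq_mul, Finset.sum_add_distrib,
        ← Finset.mul_sum, Finset.sum_sub_distrib, hv.2.2 j hj, hc'.2.2 j hj, sub_self, mul_zero,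
        add_zero]
    · simp [hvJ p hp, hsupp c p hp, hv']
  refine ⟨allocationSchedule J v, feasible_allocationSchedule hv,
    fun j => (cellSpeed J v (c j)).toNNReal ^ (α - 1), ?_, ?_⟩
  · have hnull : ∀ᵐ t, ∀ A ∈ J.powerset, cellLength J A = 0 → A.Nonempty → aliveJobs J t ≠ A := by
      refine (Finset.eventually_all _).2 fun A _ => ?_
      by_cases h : cellLength J A = 0 ∧ A.Nonempty
      · obtain ⟨h0, j, hj⟩ := h
        have h1 : volume (cell J A) = 0 := by rw [volume_cell hj, h0, ENNReal.ofReal_zero]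
        filter_upwards [measure_eq_zero_iff_ae_notMem.1 h1] with t ht _ _
        exact ht
      · exact Eventually.of_forall fun t h1 h2 => absurd ⟨h1, h2⟩ h
    filter_upwards [hnull] with t ht j hj htj
    have hmem : j ∈ aliveJobs J t := mem_aliveJobs.2 ⟨hj, htj⟩
    rw [sum_allocationSchedule hv]
    refine NNReal.rpow_le_rpow (Real.toNNReal_le_toNNReal ((hc j hj).2 _ ?_)) (sub_pos.2 hα).le
    refine mem_cellsOf.2 ⟨aliveJobs_mem_powerset J t, hmem, ?_⟩
    exact (cellLength_nonneg _).lt_of_ne' fun h0 =>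
      ht _ (aliveJobs_mem_powerset J t) h0 ⟨j, hmem⟩ rfl
  · rw [cost_allocationSchedule hα0 hv]
    refine (ENNReal.ofReal_le_ofReal hfirst).trans (le_of_eq ?_)
    have h1 : ∀ j ∈ J, ∑ A ∈ J.powerset, v' (j, A) * cellSpeed J v A ^ (α - 1) =
        j.work * cellSpeed J v (c j) ^ (α - 1) := by
      intro j hj
      rw [Finset.sum_eq_single (c j)]
      · simp [hv', singleCellAllocation, hj]
      · intro A _ hA
        simp [hv', singleCellAllocation, hA]
      · exact fun h => absurd (mem_cellsOf.1 (hc j hj).1).1 h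
    rw [Finset.sum_congr rfl h1, ENNReal.ofReal_sum_of_nonneg fun j _ => mul_nonneg
      (NNReal.coe_nonneg _) (Real.rpow_nonneg (cellSpeed_nonneg hv _) _)]
    refine Finset.sum_congr rfl fun j _ => ?_
    rw [ENNReal.ofReal_mul (NNReal.coe_nonneg _), ENNReal.ofReal_coe_nnreal,
      ← ENNReal.ofReal_rpow_of_nonneg (cellSpeed_nonneg hv _) (sub_pos.2 hα).le,
      ENNReal.coe_rpow_of_nonneg _ (sub_pos.2 hα).le]
    rfl

end Cells

/-! ### The price of shrinking -/

section ShrinkCost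

variable {δ : ℝ} (hδ : δ < 1)

/-- Shrinking finitely many intervals towards their left endpoints by the factor `1 - δ` shrinks
their union at most by this factor. -/
theorem volume_biUnion_le_shrink (hδ0 : 0 < δ) (G : Finset Job) :
    ENNReal.ofReal (1 - δ) * volume (⋃ j ∈ G, Icc j.release j.deadline) ≤
      volume (⋃ j ∈ G, Icc (j.shrink δ hδ).release (j.shrink δ hδ).deadline) := by
  classical
  have hd1 : 0 < 1 - δ := sub_pos.2 hδ
  set U := ⋃ j ∈ G, Icc j.release j.deadline with hU
  set U' := ⋃ j ∈ G, Icc (j.shrink δ hδ).release (j.shrink δ hδ).deadline with hU'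
  have hU'm : MeasurableSet U' := Finset.measurableSet_biUnion _ fun _ _ => measurableSet_Icc
  obtain ⟨T, hT⟩ := exists_bound_times G
  set g : ℝ → ℝ≥0 := U'.indicator 1 with hg
  have hgm : Measurable g := measurable_one.indicator hU'm
  have hg1 : ∀ t, g t ≤ 1 := fun t => indicator_le_self' (fun _ _ => zero_le) t
  have hweak : ∀ c : ℝ, 0 < c → c < 1 - δ → ENNReal.ofReal c * volume U ≤ volume U' := by
    intro c hc0 hc
    have h := mul_measure_lt_leftMax_le (F := G.image Job.release) hgm hg1 (a := -T) (T := T)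
      (fun r hr => by
        obtain ⟨j, hj, rfl⟩ := Finset.mem_image.1 hr
        exact (hT j hj).1) hc0
    -- For `t` in the lifetime of `j`, the first fraction `1 - δ` of `[r, t]` lies in `U'`, so the
    -- mean of `g` over `[r, t]` is at least `1 - δ > c`. The finitely many release times, where
    -- this interval may degenerate, are removed.
    have hsub : U \ (G.image Job.release : Finset ℝ) ⊆
        {t | c < leftMax (G.image Job.release) g t} ∩ Ioc (-T) T := by
      rintro t ⟨ht, htr⟩
      simp only [hU, mem_iUnion, exists_prop] at ht
      obtain ⟨j, hj, htj⟩ := ht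
      have hrt : j.release < t := lt_of_le_of_ne htj.1 fun h => htr (by
        rw [← h]; exact Finset.mem_coe.2 (Finset.mem_image_of_mem _ hj))
      refine ⟨?_, (hT j hj).1.trans_lt hrt, htj.2.trans (hT j hj).2⟩
      refine (lt_leftMax_iff hc0.le).2 ⟨_, Finset.mem_image_of_mem _ hj, hrt, ?_⟩
      have hI := intervalIntegrable_of_bdd hgm hg1
      set e := j.release + (1 - δ) * (t - j.release) with he
      have hre : j.release < e := by have := mul_pos hd1 (sub_pos.2 hrt); linarith
      have het : e ≤ t := by nlinarith
      have h1 : ∫ x in j.release..e, (g x : ℝ) = e - j.release := by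
        rw [intervalIntegral.integral_congr (g := fun _ => (1 : ℝ))]
        · simp
        · intro x hx
          rw [uIcc_of_le hre.le] at hx
          have : x ∈ U' := by
            refine mem_iUnion₂.2 ⟨j, hj, hx.1, ?_⟩
            simp only [Job.shrink]
            have := mul_le_mul_of_nonneg_left (sub_le_sub_right htj.2 j.release) hd1.le
            linarith [hx.2]
          simp [hg, this]
      have h2 : 0 ≤ ∫ x in e..t, (g x : ℝ) :=
        intervalIntegral.integral_nonneg het fun x _ => (g x).coe_nonneg
      rw [← intervalIntegral.integral_add_adjacent_intervals (hI j.release e) (hI e t), h1]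
      have := mul_lt_mul_of_pos_right hc (sub_pos.2 hrt)
      linarith
    calc ENNReal.ofReal c * volume U
        = ENNReal.ofReal c * volume (U \ (G.image Job.release : Finset ℝ)) := by
          rw [measure_sdiff_null ((G.image Job.release).finite_toSet.measure_zero _)]
      _ ≤ ENNReal.ofReal c * volume.restrict (Ioc (-T) T)
            {t | c < leftMax (G.image Job.release) g t} := by
          refine mul_le_mul_right ?_ _
          rw [Measure.restrict_apply' measurableSet_Ioc]
          exact measure_mono hsub
      _ ≤ _ := h
      _ ≤ ∫⁻ t, (g t : ℝ≥0∞) :=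
          (setLIntegral_le_lintegral _ _).trans (setLIntegral_le_lintegral _ _)
      _ = volume U' := by
          rw [← lintegral_indicator_one hU'm]
          refine lintegral_congr fun t => ?_
          by_cases ht : t ∈ U' <;> simp [hg, ht]
  have hlim : Tendsto (fun c => ENNReal.ofReal c * volume U) (𝓝[<] (1 - δ))
      (𝓝 (ENNReal.ofReal (1 - δ) * volume U)) := by
    refine ENNReal.Tendsto.mul_const ?_ (Or.inl (by simpa using hδ))
    exact (ENNReal.continuous_ofReal.tendsto _).mono_left nhdsWithin_le_nhds
  refine le_of_tendsto hlim ?_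
  filter_upwards [Ioo_mem_nhdsLT hd1] with c hc
  exact hweak c hc.1 hc.2

open Classical in
/-- The highest price of a job that is alive at time `t`. -/
noncomputable def priceAt (J : JobSet) (y : Job → ℝ≥0) (t : ℝ) : ℝ≥0 :=
  J.sup fun j => if t ∈ Icc j.release j.deadline then y j else 0

theorem setOf_lt_priceAt (J : JobSet) (y : Job → ℝ≥0) {c : ℝ} (hc : 0 ≤ c) :
    {t | c < priceAt J y t} = ⋃ j ∈ J.filter (fun j => c < y j), Icc j.release j.deadline := by
  classical
  ext t
  lift c to ℝ≥0 using hc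
  simp only [mem_ofPred_eq, NNReal.coe_lt_coe, priceAt, Finset.lt_sup_iff, mem_iUnion,
    Finset.mem_filter, exists_prop]
  refine exists_congr fun j => ?_
  by_cases ht : t ∈ Icc j.release j.deadline <;> simp [ht]

theorem measurable_priceAt (J : JobSet) (y : Job → ℝ≥0) : Measurable (priceAt J y) := by
  refine measurable_of_Ioi fun c => ?_
  have : priceAt J y ⁻¹' Ioi c = {t | (c : ℝ) < priceAt J y t} := by
    ext t; simp
  rw [this, setOf_lt_priceAt J y c.coe_nonneg]
  exact Finset.measurableSet_biUnion _ fun _ _ => measurableSet_Icc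

/-- By the layer cake formula it suffices to compare superlevel sets. These are unions of the
lifetimes of the same jobs, before and after shrinking. -/
theorem lintegral_priceAt_rpow_le (hδ0 : 0 < δ) (J : JobSet) (y : Job → ℝ≥0) {q : ℝ} (hq : 0 < q) :
    ∫⁻ t, (priceAt J (fun j => y (j.shrink δ hδ)) t : ℝ≥0∞) ^ q ≤
      ENNReal.ofReal (1 / (1 - δ)) * ∫⁻ t, (priceAt (shrink δ hδ J) y t : ℝ≥0∞) ^ q := by
  classical
  have hd1 : 0 < 1 - δ := sub_pos.2 hδ
  have layer : ∀ (Q : JobSet) (z : Job → ℝ≥0), ∫⁻ t, (priceAt Q z t : ℝ≥0∞) ^ q =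
      ENNReal.ofReal q * ∫⁻ c in Ioi (0 : ℝ),
        volume (⋃ j ∈ Q.filter (fun j => c < z j), Icc j.release j.deadline) *
          ENNReal.ofReal (c ^ (q - 1)) := by
    intro Q z
    have h := lintegral_rpow_eq_lintegral_meas_lt_mul volume (f := fun t => (priceAt Q z t : ℝ))
      (Eventually.of_forall fun t => (priceAt Q z t).coe_nonneg)
      (measurable_priceAt Q z).coe_nnreal_real.aemeasurable hq
    have e : ∀ t, ENNReal.ofReal ((priceAt Q z t : ℝ) ^ q) = (priceAt Q z t : ℝ≥0∞) ^ q := by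
      intro t
      rw [← ENNReal.ofReal_rpow_of_nonneg (NNReal.coe_nonneg _) hq.le, ENNReal.ofReal_coe_nnreal]
    simp only [e] at h
    rw [h]
    congr 1
    refine setLIntegral_congr_fun measurableSet_Ioi fun c hc => ?_
    rw [setOf_lt_priceAt Q z (mem_Ioi.1 hc).le]
  rw [layer, layer, ← mul_assoc, mul_comm (ENNReal.ofReal (1 / (1 - δ))), mul_assoc,
    ← lintegral_const_mul' (ENNReal.ofReal (1 / (1 - δ))) _ ENNReal.ofReal_ne_top]
  refine mul_le_mul_right (lintegral_mono fun c => ?_) _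
  dsimp only
  rw [← mul_assoc]
  refine mul_le_mul_left ?_ _
  have h := volume_biUnion_le_shrink hδ hδ0 (J.filter fun j => c < y (j.shrink δ hδ))
  have e : (⋃ j ∈ (shrink δ hδ J).filter (fun j => c < y j), Icc j.release j.deadline) =
      ⋃ j ∈ J.filter (fun j => c < y (j.shrink δ hδ)),
        Icc (j.shrink δ hδ).release (j.shrink δ hδ).deadline := by
    ext t
    simp only [mem_iUnion, Finset.mem_filter, shrink, Finset.mem_image, exists_prop]
    constructor
    · rintro ⟨_, ⟨⟨j, hj, rfl⟩, hc⟩, ht⟩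
      exact ⟨j, ⟨hj, hc⟩, ht⟩
    · rintro ⟨j, ⟨hj, hc⟩, ht⟩
      exact ⟨_, ⟨⟨j, hj, rfl⟩, hc⟩, ht⟩
  rw [e, one_div, ENNReal.ofReal_inv_of_pos hd1, mul_comm, ← div_eq_mul_inv,
    ENNReal.le_div_iff_mul_le (Or.inl (by simpa using hδ)) (Or.inl ENNReal.ofReal_ne_top), mul_comm]
  exact h

/-- Shrinking the jobs increases the optimal cost at most by the factor `(1 / (1 - δ)) ^ (α - 1)`. -/
theorem exists_feasible_shrink_cost_le (hδ0 : 0 < δ) {α : ℝ} (hα : 1 < α) (J : JobSet) :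
    ∃ s : Schedule, Feasible (shrink δ hδ J) s ∧ ∀ s', Feasible J s' →
      cost α (shrink δ hδ J) s ≤ ENNReal.ofReal (1 / (1 - δ)) ^ (α - 1) * cost α J s' := by
  classical
  obtain ⟨s, hs, y, hy, hcost⟩ := exists_optimal_schedule hα (shrink δ hδ J)
  refine ⟨s, hs, fun s' hs' => ?_⟩
  set q := α.conjExponent with hq
  have hpq : α.HolderConjugate q := Real.HolderConjugate.conjExponent hα
  have hq0 : 0 < q := hpq.symm.pos
  set X := cost α (shrink δ hδ J) s with hX
  have hXt : X ≠ ⊤ := by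
    refine ne_top_of_le_ne_top ?_ hcost
    exact (ENNReal.sum_lt_top.2 fun j _ =>
      ENNReal.mul_lt_top ENNReal.coe_lt_top ENNReal.coe_lt_top).ne
  set Y := priceAt J fun j => y (j.shrink δ hδ) with hY
  have hYm : Measurable Y := measurable_priceAt _ _
  -- After shrinking, the highest price is almost everywhere at most the speed to the power `α - 1`,
  -- whose q-th power is the integrand of `X`.
  have hYq : ∫⁻ t, (Y t : ℝ≥0∞) ^ q ≤ ENNReal.ofReal (1 / (1 - δ)) * X := by
    refine (lintegral_priceAt_rpow_le hδ hδ0 J y hq0).trans ?_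
    gcongr
    rw [hX, cost]
    refine lintegral_mono_ae ?_
    filter_upwards [hy] with t ht
    have h1 : priceAt (shrink δ hδ J) y t ≤ (∑ i ∈ shrink δ hδ J, s i t) ^ (α - 1) := by
      refine Finset.sup_le fun j hj => ?_
      split_ifs with h
      · exact ht j hj h
      · exact zero_le
    refine (ENNReal.rpow_le_rpow (ENNReal.coe_le_coe.2 h1) hq0.le).trans (le_of_eq ?_)
    rw [ENNReal.coe_rpow_of_nonneg _ (sub_pos.2 hα).le, ← ENNReal.rpow_mul]
    congr 1
    have := hpq.mul_eq_add
    linarith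
  have hjob : ∀ j ∈ J, (j.work : ℝ≥0∞) * y (j.shrink δ hδ) ≤ ∫⁻ t, (s' j t : ℝ≥0∞) * Y t := by
    intro j hj
    rw [← hs'.lintegral_eq hj, ← lintegral_mul_const _ (hs' j hj).1.coe_nnreal_ennreal]
    refine lintegral_mono fun t => ?_
    by_cases ht : t ∈ Icc j.release j.deadline
    · dsimp only
      gcongr
      have := Finset.le_sup (f := fun j : Job => if t ∈ Icc j.release j.deadline then
        y (j.shrink δ hδ) else 0) hj
      rw [if_pos ht] at this
      rw [hY, priceAt]
      convert this
    · simp [(hs' j hj).2.1 t ht]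
  have hmain : X ≤ cost α J s' ^ (1 / α) * (ENNReal.ofReal (1 / (1 - δ)) * X) ^ (1 / q) := by
    calc X ≤ ∑ j ∈ J, ∫⁻ t, (s' j t : ℝ≥0∞) * Y t := by
          refine hcost.trans ?_
          rw [sum_shrink]
          exact Finset.sum_le_sum hjob
      _ = ∫⁻ t, ∑ j ∈ J, (s' j t : ℝ≥0∞) * Y t :=
          (lintegral_finsetSum _ fun j hj =>
            (hs' j hj).1.coe_nnreal_ennreal.mul hYm.coe_nnreal_ennreal).symm
      _ = ∫⁻ t, ((fun t => ((∑ j ∈ J, s' j t : ℝ≥0) : ℝ≥0∞)) * fun t => (Y t : ℝ≥0∞)) t := by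
          refine lintegral_congr fun t => ?_
          rw [Pi.mul_apply, ENNReal.ofNNReal_finsetSum, Finset.sum_mul]
      _ ≤ _ := ENNReal.lintegral_mul_le_Lp_mul_Lq _ hpq
            ((Finset.measurable_fun_sum _ fun j hj => (hs' j hj).1).coe_nnreal_ennreal.aemeasurable)
            hYm.coe_nnreal_ennreal.aemeasurable
      _ ≤ _ := by
          gcongr
          exact le_rfl
  exact le_of_le_rpow_mul_rpow hpq hXt hmain

end ShrinkCost

/-! ### Following a prediction -/

section Prediction

/-- A job with given data is processed like the average predicted job with the same data, and
with constant speed if no such job is predicted. -/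
noncomputable def predictedSpeed (Q : JobSet) (s : Schedule) (D : ℝ × ℝ × ℝ≥0) (t : ℝ) : ℝ≥0 :=
  open Classical in
  if (Q.filter fun k => k.data = D).card = 0 then
    (Icc D.1 D.2.1).indicator (fun _ => D.2.2 / (D.2.1 - D.1).toNNReal) t
  else (∑ k ∈ Q.filter fun k => k.data = D, s k t) / (Q.filter fun k => k.data = D).card

/-- The schedule that follows a schedule `s` of a predicted instance `Q`. -/
noncomputable def followPrediction (Q : JobSet) (s : Schedule) : Schedule :=
  fun j => predictedSpeed Q s j.data

theorem feasible_followPrediction {Q : JobSet} {s : Schedule} (hs : Feasible Q s) (J : JobSet) :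
    Feasible J (followPrediction Q s) := by
  classical
  intro j _
  by_cases hQ : (Q.filter fun k => k.data = j.data).card = 0
  · have e : followPrediction Q s j =
        (Icc j.release j.deadline).indicator fun _ => j.density := by
      funext t
      simp only [followPrediction, predictedSpeed, if_pos hQ]
      rfl
    rw [e]
    refine ⟨measurable_const.indicator measurableSet_Icc, fun t ht => indicator_of_notMem ht _, ?_⟩
    rw [setLIntegral_congr_fun (g := fun _ => (j.density : ℝ≥0∞)) measurableSet_Icc
      fun t ht => by simp only [indicator_of_mem ht], setLIntegral_const, Real.volume_Icc,
      j.density_mul]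
  · set F := Q.filter fun k => k.data = j.data with hF
    have e : followPrediction Q s j = fun t => (∑ k ∈ F, s k t) / (F.card : ℝ≥0) := by
      funext t
      exact if_neg hQ
    have hk : ∀ k ∈ F, k ∈ Q ∧ k.release = j.release ∧ k.deadline = j.deadline ∧
        k.work = j.work := by
      intro k hk
      obtain ⟨hkQ, hkd⟩ := Finset.mem_filter.1 hk
      simp only [Job.data, Prod.mk.injEq] at hkd
      exact ⟨hkQ, hkd⟩
    rw [e]
    refine ⟨(Finset.measurable_fun_sum _ fun k hkF => (hs k (hk k hkF).1).1).div_const _,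
      fun t ht => ?_, ?_⟩
    · dsimp only
      rw [Finset.sum_eq_zero, zero_div]
      intro k hkF
      obtain ⟨hkQ, hr, hd, _⟩ := hk k hkF
      exact (hs k hkQ).2.1 t (by rwa [hr, hd])
    · have hc : (F.card : ℝ≥0) ≠ 0 := by exact_mod_cast hQ
      have e2 : ∀ t, (((∑ k ∈ F, s k t) / (F.card : ℝ≥0) : ℝ≥0) : ℝ≥0∞) =
          (∑ k ∈ F, (s k t : ℝ≥0∞)) * ((F.card : ℝ≥0) : ℝ≥0∞)⁻¹ := fun t => by
        rw [ENNReal.coe_div hc, ENNReal.ofNNReal_finsetSum, div_eq_mul_inv]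
      simp only [e2]
      rw [lintegral_mul_const _ (Finset.measurable_fun_sum _ fun k hkF =>
        (hs k (hk k hkF).1).1.coe_nnreal_ennreal), lintegral_finsetSum _ fun k hkF =>
        (hs k (hk k hkF).1).1.coe_nnreal_ennreal]
      have h1 : ∀ k ∈ F, ∫⁻ t in Icc j.release j.deadline, (s k t : ℝ≥0∞) = j.work := by
        intro k hkF
        obtain ⟨hkQ, hr, hd, hw⟩ := hk k hkF
        rw [← hr, ← hd, ← hw]
        exact (hs k hkQ).2.2
      rw [Finset.sum_congr rfl h1, Finset.sum_const, nsmul_eq_mul, mul_right_comm,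
        ENNReal.coe_natCast, ENNReal.mul_inv_cancel (by exact_mod_cast hQ)
          (ENNReal.natCast_ne_top _), one_mul]

/-- The speed of a job is a function of its own data and the prediction alone, so the other jobs of
the real instance are irrelevant. -/
theorem isOnlineAlgorithm_followPrediction {Q : JobSet} {s : Schedule} (hs : Feasible Q s) :
    IsOnlineAlgorithm fun _ => followPrediction Q s :=
  ⟨feasible_followPrediction hs, fun _ _ _ _ _ _ _ _ _ => rfl⟩

/-- The speed of `k` is divided among the n jobs with its data, each receiving an n-th part.
Averaging thus keeps the total speed while forgetting names. -/
theorem sum_predictedSpeed (Q : JobSet) (s : Schedule) (t : ℝ) :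
    ∑ i ∈ Q, predictedSpeed Q s i.data t = ∑ k ∈ Q, s k t := by
  classical
  have h1 : ∀ i ∈ Q, predictedSpeed Q s i.data t =
      ∑ k ∈ Q, if k.data = i.data then
        s k t / (Q.filter fun l => l.data = k.data).card else 0 := by
    intro i hi
    have hne : (Q.filter fun k => k.data = i.data).card ≠ 0 :=
      (Finset.card_pos.2 ⟨i, by simp [hi]⟩).ne'
    rw [predictedSpeed, if_neg hne, Finset.sum_div, Finset.sum_filter]
    refine Finset.sum_congr rfl fun k _ => ?_
    split_ifs with h
    · rw [h]
    · rfl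
  rw [Finset.sum_congr rfl h1, Finset.sum_comm]
  refine Finset.sum_congr rfl fun k hk => ?_
  have h2 : (Q.filter fun l => l.data = k.data).card ≠ 0 :=
    (Finset.card_pos.2 ⟨k, by simp [hk]⟩).ne'
  have h3 : (Q.filter fun i => k.data = i.data) = Q.filter fun l => l.data = k.data :=
    Finset.filter_congr fun _ _ => eq_comm
  rw [← Finset.sum_filter, Finset.sum_const, h3, nsmul_eq_mul,
    mul_div_cancel₀ _ (by exact_mod_cast h2)]

theorem Accurate.sum_eq {P J : JobSet} (h : Accurate P J) (f : ℝ × ℝ × ℝ≥0 → ℝ≥0) :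
    ∑ j ∈ J, f j.data = ∑ j ∈ P, f j.data := by
  have := congrArg (fun m => (m.map f).sum) h
  simp only [Multiset.map_map] at this
  exact this.symm

theorem Accurate.cost_followPrediction {P J : JobSet} (h : Accurate P J) (α : ℝ) (s : Schedule) :
    cost α J (followPrediction P s) = cost α P s := by
  refine lintegral_congr fun t => ?_
  rw [← sum_predictedSpeed P s t]
  exact congrArg (fun x : ℝ≥0 => (x : ℝ≥0∞) ^ α) (h.sum_eq fun D => predictedSpeed P s D t)

theorem Accurate.shrink {P J : JobSet} (h : Accurate P J) {δ : ℝ} (hδ : δ < 1) :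
    Accurate (shrink δ hδ P) (shrink δ hδ J) := by
  classical
  have hval : ∀ Q : JobSet, (SpeedScaling.shrink δ hδ Q).val.map Job.data =
      (Q.val.map Job.data).map fun D => (D.1, D.1 + (1 - δ) * (D.2.1 - D.1), D.2.2) := by
    intro Q
    rw [SpeedScaling.shrink, Finset.image_val_of_injOn (Job.shrink_injective δ hδ).injOn,
      Multiset.map_map, Multiset.map_map]
    rfl
  rw [Accurate, hval, hval, h]

/-- One factor pays for shrinking, the other for converting. With δ = η / (8α) ≤ 1/2 one has 1 / (1
- δ) ≤ e^(2δ), so each factor is at most e^(η/4). -/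
theorem one_div_one_sub_rpow_mul_self_le {α ε : ℝ} (hα : 1 < α) (hε : 0 < ε) :
    (1 / (1 - min ε 1 / (8 * α))) ^ (α - 1) * (1 / (1 - min ε 1 / (8 * α))) ^ (α - 1) ≤ 1 + ε := by
  set η := min ε 1 with hη
  have hη0 : 0 < η := lt_min hε one_pos
  have hη1 : η ≤ 1 := min_le_right _ _
  have hα0 : 0 < α := zero_lt_one.trans hα
  set δ := η / (8 * α) with hδ
  have hδα : δ * α = η / 8 := by rw [hδ]; field_simp
  have hδ0 : 0 < δ := by positivity
  have hδ2 : δ ≤ 1 / 2 := by nlinarith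
  have hd1 : 0 < 1 - δ := by linarith
  have h1 : 1 / (1 - δ) ≤ Real.exp (2 * δ) := by
    refine le_trans ?_ (Real.add_one_le_exp (2 * δ))
    rw [div_le_iff₀ hd1]
    nlinarith
  have h2 : (1 / (1 - δ)) ^ (α - 1) ≤ Real.exp (η / 4) := by
    refine (Real.rpow_le_rpow (by positivity) h1 (sub_pos.2 hα).le).trans ?_
    rw [← Real.exp_mul]
    exact Real.exp_le_exp.2 (by linarith)
  have h3 : Real.exp (η / 2) ≤ 1 + η := by
    have h4 := Real.add_one_le_exp (-(η / 2))
    rw [Real.exp_neg] at h4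
    have h5 : 0 < -(η / 2) + 1 := by linarith
    have h6 := inv_anti₀ h5 h4
    rw [inv_inv] at h6
    refine h6.trans ?_
    rw [inv_le_iff_one_le_mul₀ h5]
    nlinarith
  calc _ ≤ Real.exp (η / 4) * Real.exp (η / 4) := by gcongr
    _ = Real.exp (η / 2) := by rw [← Real.exp_add]; ring_nf
    _ ≤ 1 + η := h3
    _ ≤ 1 + ε := by linarith [min_le_left ε 1]

/-- Following the prediction robustly is consistent and robust. -/
theorem exists_learningAugmented {α : ℝ} (hα : 1 < α) {ε : ℝ} (hε : 0 < ε) :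
    ∃ A : JobSet → JobSet → Schedule, IsLearningAugmented A ∧
      (∀ P J : JobSet, Accurate P J → cost α J (A P J) ≤ ENNReal.ofReal (1 + ε) * OPT α J) ∧
      ∀ P J : JobSet,
        cost α J (A P J) ≤ ENNReal.ofReal ((128 * α ^ 3 / (min ε 1) ^ 2) ^ α) * OPT α J := by
  have hη0 : 0 < min ε 1 := lt_min hε one_pos
  have hα0 : 0 < α := zero_lt_one.trans hα
  have hbound := one_div_one_sub_rpow_mul_self_le hα hε
  obtain ⟨δ, hδdef⟩ : ∃ δ, δ = min ε 1 / (8 * α) := ⟨_, rfl⟩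
  rw [← hδdef] at hbound
  have hδ0 : 0 < δ := by rw [hδdef]; positivity
  have hδ : δ < 1 := by
    rw [hδdef, div_lt_one (by positivity)]
    linarith [min_le_right ε 1]
  have hd1 : 0 < 1 - δ := sub_pos.2 hδ
  choose s hs hcost using fun P : JobSet => exists_feasible_shrink_cost_le hδ hδ0 hα P
  have hfeas : ∀ P J : JobSet, Feasible (shrink δ hδ J) (followPrediction (shrink δ hδ P) (s P)) :=
    fun P J => feasible_followPrediction (hs P) _
  refine ⟨fun P J => conversion δ hδ J (followPrediction (shrink δ hδ P) (s P)), fun P => ?_,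
    fun P J hPJ => ?_, fun P J => ?_⟩
  · exact (isOnlineConversion_conversion δ hδ hδ0).isOnlineAlgorithm δ hδ
      (A := fun _ => followPrediction (shrink δ hδ P) (s P))
      (isOnlineAlgorithm_followPrediction (hs P))
  · have hne : ENNReal.ofReal (1 + ε) ≠ 0 := by
      rw [Ne, ENNReal.ofReal_eq_zero, not_le]
      positivity
    rw [OPT, ENNReal.mul_iInf_of_ne hne ENNReal.ofReal_ne_top]
    refine le_iInf fun s' => ?_
    rw [ENNReal.mul_iInf_of_ne hne ENNReal.ofReal_ne_top]
    refine le_iInf fun hs' => ?_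
    have hJP : Accurate J P := Eq.symm hPJ
    have h1 := hcost P _ (feasible_followPrediction hs' P)
    rw [hJP.cost_followPrediction] at h1
    refine (cost_conversion_le δ hδ hδ0 hα (hfeas P J)).trans ?_
    rw [(hPJ.shrink hδ).cost_followPrediction]
    refine (mul_le_mul_right h1 _).trans ?_
    rw [ENNReal.ofReal_rpow_of_pos (by positivity), ← mul_assoc,
      ← ENNReal.ofReal_mul (by positivity)]
    gcongr
  · refine (cost_conversion_le_opt δ hδ hδ0 hα (hfeas P J)).trans ?_
    gcongr
    -- 128 = 2 · 8², the 8 coming from the choice of `δ`; the further factor 1/2 is given away.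
    have e : 2 * α / δ ^ 2 = 128 * α ^ 3 / (min ε 1) ^ 2 := by
      rw [hδdef]
      field_simp
      norm_num
    rw [e]
    exact half_le_self (by positivity)

end Prediction

end SpeedScaling

theorem mainTheorem11 :
    -- robustification of schedules of the shrunk instance
    (∀ (δ : ℝ) (_ : 0 < δ) (hδ : δ < 1), ∃ R : JobSet → Schedule → Schedule,
      IsOnlineConversion δ hδ R ∧
      (∀ (α : ℝ), 1 < α → ∀ (J : JobSet) (s : Schedule), Feasible (shrink δ hδ J) s →
        cost α J (R J s) ≤
          min (ENNReal.ofReal ((1 / (1 - δ)) ^ (α - 1)) * cost α (shrink δ hδ J) s)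
            (ENNReal.ofReal ((2 * α / δ ^ 2) ^ α / 2) * OPT α J)) ∧
      -- hence every online algorithm, run on the shrunk instance, is robustified online
      (∀ A : JobSet → Schedule, IsOnlineAlgorithm A →
        IsOnlineAlgorithm (fun J => R J (A (shrink δ hδ J))))) ∧
    -- the consistent and robust learning-augmented algorithm
    (∃ K : ℝ, 0 < K ∧ ∀ (α : ℝ), 1 < α → ∀ (ε : ℝ), 0 < ε →
      ∃ A : JobSet → JobSet → Schedule, IsLearningAugmented A ∧
        (∀ P J : JobSet, Accurate P J →
          cost α J (A P J) ≤ ENNReal.ofReal (1 + ε) * OPT α J) ∧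
        (∀ P J : JobSet,
          cost α J (A P J) ≤ ENNReal.ofReal ((K * α ^ 3 / (min ε 1) ^ 2) ^ α) * OPT α J)) := by
  refine ⟨fun δ hδ0 hδ => ⟨conversion δ hδ, isOnlineConversion_conversion δ hδ hδ0,
    fun α hα J s hs => le_min (cost_conversion_le δ hδ hδ0 hα hs)
      (cost_conversion_le_opt δ hδ hδ0 hα hs),
    fun A hA => (isOnlineConversion_conversion δ hδ hδ0).isOnlineAlgorithm δ hδ hA⟩,
    128, by norm_num, fun α hα ε hε => exists_learningAugmented hα hε⟩
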